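/- **Definitions.** For $r\ge 0$ let $\Lambda_r$ be the collection of triples $(H,v,x)$ where $(H,v)$ is a finite connected rooted graph all of whose vertices are within distance $r$ of the root $v$, and $x\in[0,1]^{V(H)}$ is a labelling. A *factor* of radius $r$ is a function $f:\Lambda_r\to\{0,1\}$ that is Borel measurable in $x$ for each $(H,v)$ and invariant under root-preserving isomorphisms. Given a finite graph $G$ with labels $x\in[0,1]^{V(G)}$, the set *generated by* $f$ on $(G,x)$ is the set of vertices $v$ with $f(N_r(G,v),v,x|_{N_r(G,v)})=1$, where $N_r(G,v)$ is the subgraph induced on the vertices at distance at most $r$ from $v$. $ER(n,q)$ is the random graph on $n$ vertices in which each pair is an edge independently with probability $q$; $ER(n,\lambda/n)$ means $q=\min(\lambda/n,1)$. A *random labelling* consists of i.i.d. uniform labels on $[0,1]$. Let $L\subseteq(0,\infty)$ be an unbounded set (for instance $(0,\infty)$, or the values of a sequence tending to infinity). For each $\lambda\in L$ let $r_\lambda\ge 0$ be an integer and, for each $n$, let $f_{n,\lambda}$ be a factor of radius $r_\lambda$ such that, for all sufficiently large $n$ (depending on $\lambda$), the set generated by $f_{n,\lambda}$ on a randomly labelled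 $G_n\sim ER(n,\lambda/n)$ is almost surely an independent set of $G_n$. **Coupling.** For $p\in[0,1]$ let $G_n\sim ER(n,\lambda/n)$ have a random labelling $X$, let $S$ be a random set of vertices containing each vertex independently with probability $p$, let $H^1,H^2,\ldots\sim ER(n,\lambda/n)$ and let $X^1,X^2,\ldots$ be random labellings, all of these being independent. Let $G^t$ be the graph that agrees with $H^t$ on pairs $\{u,v\}\subseteq S$ and with $G_n$ on all other pairs, and let $Y^t(v)=X^t(v)$ if $v\in S$ and $Y^t(v)=X(v)$ otherwise. Let $I^t$ be the set generated by $f_{n,\lambda}$ on $(G^t,Y^t)$, and define $\alpha_{i,n,\lambda,p}$ for $i\ge1$ by $$\alpha_{i,n,\lambda,p}\,\frac{\log\lambda}{\lambda}=\mathbb E\left[\frac{|I^1\cap\cdots\cap I^i|}{n}\right].$$ **Theorem.** For each $k\ge 1$, $$\liminf_{\substack{\lambda\to\infty\\ \lambda\in L}}\ \liminf_{n\to\infty}\ \inf_{p\in[0,1]}\ \sum_{i=1}^k(-1)^{i-1}\binom ki\,\alpha_{i,n,\lambda,p}\,(2-\alpha_{i,n,\lambda,p})\ \ge\ 0 .$$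 -/

import Mathlib

open MeasureTheory ProbabilityTheory Filter
open scoped unitInterval SimpleGraph

namespace LocalAlg

/-- A finite connected rooted graph all of whose vertices are at distance at most `r` from the
root. -/
structure RootedGraph (r : ℕ) where
  V : Type
  finite : Finite V
  graph : SimpleGraph V
  root : V
  connected : graph.Connected
  dist_le : ∀ u, graph.dist u root ≤ r

/-- The space of triples `(H, v, x)`: a rooted graph `(H, v)` of radius at most `r` and a labelling
`x` of its vertices by `[0,1]`.  The `σ`-algebra is the one of the disjoint union (over the rooted
graphs) of the spaces `[0,1]^{V(H)}` with their Borel `σ`-algebras. -/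
abbrev LabelledGraph (r : ℕ) : Type 1 := Σ H : RootedGraph r, (H.V → I)

/-- A factor of radius `r`: a measurable `{0,1}`-valued function of labelled rooted graphs that is
invariant under root preserving isomorphisms. -/
structure Factor (r : ℕ) where
  toFun : LabelledGraph r → Bool
  measurable_toFun : Measurable toFun
  invariant : ∀ (H H' : RootedGraph r) (φ : H.graph ≃g H'.graph), φ H.root = H'.root →
    ∀ x : H.V → I, toFun ⟨H, x⟩ = toFun ⟨H', x ∘ φ.symm⟩

section Ball

variable {V : Type} (G : SimpleGraph V) (r : ℕ) (v : V)

/-- The set of vertices at distance at most `r` from `v`; vertices in other components are at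
infinite distance. -/
def closedBall : Set V := {u | G.edist u v ≤ r}

lemma self_mem_closedBall : v ∈ closedBall G r v := by
  simp [closedBall]

lemma exists_walk_induce {u : V} (hu : u ∈ closedBall G r v) :
    ∃ w : (G.induce (closedBall G r v)).Walk ⟨u, hu⟩ ⟨v, self_mem_closedBall G r v⟩,
      w.length ≤ r := by
  have hr : G.Reachable u v := by
    rw [← SimpleGraph.edist_ne_top_iff_reachable]
    exact ne_top_of_le_ne_top (ENat.natCast_ne_top r) hu
  obtain ⟨p, hp⟩ := hr.exists_walk_length_eq_edist
  have hpr : p.length ≤ r := by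
    have h : G.edist u v ≤ r := hu
    rw [← hp] at h
    exact_mod_cast h
  have hs : ∀ x ∈ p.support, x ∈ closedBall G r v := by
    classical
    intro x hx
    have h1 : (p.dropUntil x hx).length ≤ p.length := p.length_dropUntil_le_length hx
    have h2 : G.edist x v ≤ (p.dropUntil x hx).length := SimpleGraph.edist_le _
    exact h2.trans (by exact_mod_cast h1.trans hpr)
  refine ⟨p.induce _ hs, ?_⟩
  have h := congrArg SimpleGraph.Walk.length (p.map_induce hs)
  rw [SimpleGraph.Walk.length_map] at h
  exact h.le.trans hpr

/-- The `r`-neighbourhood `N_r(G, v)` of `v` in `G`, rooted at `v`. -/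
def rootedBall [Finite V] : RootedGraph r where
  V := closedBall G r v
  finite := inferInstance
  graph := G.induce (closedBall G r v)
  root := ⟨v, self_mem_closedBall G r v⟩
  connected := by
    have : Nonempty (closedBall G r v) := ⟨⟨v, self_mem_closedBall G r v⟩⟩
    refine ⟨fun a b => ?_⟩
    obtain ⟨w₁, -⟩ := exists_walk_induce G r v a.2
    obtain ⟨w₂, -⟩ := exists_walk_induce G r v b.2
    exact w₁.reachable.trans w₂.reachable.symm
  dist_le := fun u => by
    obtain ⟨w, hw⟩ := exists_walk_induce G r v u.2
    exact (SimpleGraph.dist_le w).trans hw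

end Ball

/-- The set of vertices selected by the factor `f` on the graph `G` with labels `x`, i.e.
`v` is selected when `f (N_r(G,v), v, x restricted to N_r(G,v)) = 1`. -/
def Factor.select {r : ℕ} (f : Factor r) {V : Type} [Finite V] (G : SimpleGraph V)
    (x : V → I) : Set V :=
  {v | f.toFun ⟨rootedBall G r v, fun u => x u.1⟩ = true}

/-- The edge probability `lam / n`, truncated to `[0,1]` (the truncation is only active for
`n < lam` or `lam < 0`). -/
noncomputable def edgeProb (lam : ℝ) (n : ℕ) : I := Set.projIcc 0 1 zero_le_one (lam / n)

/-- The law of the Erdős–Rényi graph `ER(n, q)` together with an independent random labelling of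
its vertices by i.i.d. uniform `[0,1]` labels. -/
noncomputable def labelledER (n : ℕ) (q : I) : Measure (SimpleGraph (Fin n) × (Fin n → I)) :=
  (SimpleGraph.binomialRandom (Fin n) q).prod volume

/-- The set selected by `f` in the randomly labelled `ER(n, q)` is almost surely independent. -/
def Factor.IsIndepOnER {r : ℕ} (f : Factor r) (n : ℕ) (q : I) : Prop :=
  ∀ᵐ ω ∂(labelledER n q), ω.1.IsIndepSet (f.select ω.1 ω.2)

/-- The sample space of the coupling: `((G, X), S)` consists of the base graph, the base labelling
and the percolation set; the `t`-th entry of the sequence consists of the fresh graph used to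
resample the edges inside `S` and the fresh labelling `X^t`. -/
abbrev Sample (n : ℕ) : Type :=
  ((SimpleGraph (Fin n) × (Fin n → I)) × Set (Fin n)) ×
    (ℕ → SimpleGraph (Fin n) × (Fin n → I))

/-- All the ingredients are independent; `S` is a Bernoulli percolation of density `p`. -/
noncomputable def couplingMeasure (n : ℕ) (q p : I) : Measure (Sample n) :=
  ((labelledER n q).prod (setBernoulli Set.univ p)).prod
    (Measure.infinitePi fun _ : ℕ => labelledER n q)

/-- The graph which agrees with `H` on pairs of vertices inside `S` and with `G` on all other
pairs. -/
def resampleGraph {V : Type} (G H : SimpleGraph V) (S : Set V) : SimpleGraph V where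
  Adj u v := ((u ∈ S ∧ v ∈ S) ∧ H.Adj u v) ∨ (¬ (u ∈ S ∧ v ∈ S) ∧ G.Adj u v)
  symm := ⟨fun u v h => by simpa only [and_comm (a := v ∈ S), H.adj_comm v, G.adj_comm v] using h⟩
  loopless := ⟨fun u h => by simp at h⟩

open Classical in
/-- The labelling which agrees with `x'` on `S` and with `x` off `S`. -/
noncomputable def resampleLabel {V : Type} (x x' : V → I) (S : Set V) : V → I :=
  fun v => if v ∈ S then x' v else x v

/-- The `t`-th coupled graph `G^t`. -/
def coupledGraph {n : ℕ} (ω : Sample n) (t : ℕ) : SimpleGraph (Fin n) :=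
  resampleGraph ω.1.1.1 (ω.2 t).1 ω.1.2

/-- The `t`-th coupled labelling `Y^t`. -/
noncomputable def coupledLabel {n : ℕ} (ω : Sample n) (t : ℕ) : Fin n → I :=
  resampleLabel ω.1.1.2 (ω.2 t).2 ω.1.2

/-- The `t`-th coupled set `I^t`, generated by `f` on the graph `G^t` with the labels `Y^t`. -/
def Factor.coupledSet {r : ℕ} (f : Factor r) {n : ℕ} (ω : Sample n) (t : ℕ) : Set (Fin n) :=
  f.select (coupledGraph ω t) (coupledLabel ω t)

/-- The expected density of the intersection of the first `i` coupled sets. -/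
noncomputable def Factor.interDensity {r : ℕ} (f : Factor r) (n : ℕ) (q p : I) (i : ℕ) : ℝ :=
  ∫ ω, ((⋂ t ∈ Finset.range i, f.coupledSet ω t).ncard : ℝ) / n ∂(couplingMeasure n q p)

/-- The normalized intersection density: `alpha * (log lam / lam)` is the expected intersection
density of the first `i` coupled sets on `ER(n, lam / n)`. -/
noncomputable def Factor.alpha {r : ℕ} (f : Factor r) (n : ℕ) (lam : ℝ) (p : I) (i : ℕ) : ℝ :=
  f.interDensity n (edgeProb lam n) p i / (Real.log lam / lam)

end LocalAlg

/-! The proof is a first moment argument over patterns. The pattern of a vertex is the set of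
indices t < k whose coupled set contains it. Let a_i be the expected density of the intersection of
i coupled sets, and let A and A₂ be the alternating binomial sums of a_i and of a_i². By
inclusion-exclusion, if all intersections have roughly their expected sizes, about n A vertices have
a nonempty pattern, and about n² A₂ ordered pairs of vertices have intersecting patterns
(`card_nonempty_pattern`, `card_intersecting_pairs`).

Up to a factor exp(O(2^k n / λ)), there are at most λ^(n A) such patterns
(`sum_prod_pattern_weight_le`). For a fixed one, all k sets are independent with probability at most
about (1 - λ/n)^(n² A₂ / 2): whatever S is, every pair with intersecting patterns must avoid at
least one edge coin of its own (`prob_isIndepSet_le`). The true pattern has typical counts with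
probability at least 1/2, so the union bound cannot be smaller than 1/2. Taking logarithms and
substituting a_i = α_i log λ / λ shows that the alternating sum of α_i (2 - α_i) is at least -O(2^k
/ log² λ), uniformly in p.

Typical counts come from Chebyshev's inequality. Membership in the coupled sets is decided by a ball
of bounded radius in the union of all graphs involved; such events at distant vertices are nearly
uncorrelated, so the counts have variance O(n) (`Resampling.variance_sum_indicator_le`).
Decorrelation is obtained without conditioning, by merging two independent samples along a fixed
vertex set. -/

namespace LocalAlg

/-! ### Balls in graphs and locality of factors -/

section BallLemmas

variable {V : Type}

lemma mem_closedBall_zero {G : SimpleGraph V} {u x : V} : x ∈ closedBall G 0 u ↔ x = u := by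
  simp [closedBall]

lemma mem_closedBall_iff_exists_walk {G : SimpleGraph V} {r : ℕ} {u x : V} :
    x ∈ closedBall G r u ↔ ∃ w : G.Walk x u, w.length ≤ r := by
  constructor
  · intro h
    have hr : G.Reachable x u := by
      rw [← SimpleGraph.edist_ne_top_iff_reachable]
      exact ne_top_of_le_ne_top (ENat.natCast_ne_top r) h
    obtain ⟨p, hp⟩ := hr.exists_walk_length_eq_edist
    refine ⟨p, ?_⟩
    have h' : G.edist x u ≤ r := h
    rw [← hp] at h'
    exact_mod_cast h'
  · rintro ⟨w, hw⟩
    exact (SimpleGraph.edist_le w).trans (by exact_mod_cast hw)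

lemma mem_closedBall_succ {G : SimpleGraph V} {r : ℕ} {u x : V} :
    x ∈ closedBall G (r + 1) u ↔ x = u ∨ ∃ y, G.Adj x y ∧ y ∈ closedBall G r u := by
  simp only [mem_closedBall_iff_exists_walk]
  constructor
  · rintro ⟨w, hw⟩
    cases w with
    | nil => exact Or.inl rfl
    | cons h q => exact Or.inr ⟨_, h, q, by simpa using hw⟩
  · rintro (rfl | ⟨y, h, q, hq⟩)
    · exact ⟨.nil, by simp⟩
    · exact ⟨.cons h q, by simpa using hq⟩

lemma closedBall_mono_radius {G : SimpleGraph V} {r s : ℕ} (h : r ≤ s) (u : V) :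
    closedBall G r u ⊆ closedBall G s u := fun _ hx =>
  le_trans (show G.edist _ u ≤ r from hx) (by exact_mod_cast h)

lemma closedBall_mono {G H : SimpleGraph V} (h : G ≤ H) (r : ℕ) (u : V) :
    closedBall G r u ⊆ closedBall H r u := fun _ hx =>
  (SimpleGraph.edist_anti h).trans hx

lemma mem_closedBall_comm {G : SimpleGraph V} {r : ℕ} {u v : V} :
    u ∈ closedBall G r v ↔ v ∈ closedBall G r u := by
  simp only [closedBall, Set.mem_ofPred_eq, SimpleGraph.edist_comm]

lemma mem_closedBall_add {G : SimpleGraph V} {r s : ℕ} {u v w : V}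
    (hu : w ∈ closedBall G r u) (hv : w ∈ closedBall G s v) : v ∈ closedBall G (r + s) u := by
  have h1 : G.edist w u ≤ r := hu
  have h2 : G.edist w v ≤ s := hv
  show G.edist v u ≤ (r + s : ℕ)
  calc G.edist v u ≤ G.edist v w + G.edist w u := SimpleGraph.edist_triangle
    _ ≤ s + r := by rw [SimpleGraph.edist_comm]; gcongr
    _ = (r + s : ℕ) := by push_cast; ring

/-- If two graphs agree inside `C` and a ball of the first is contained in `C`, then it is contained
in the corresponding ball of the second. -/
lemma closedBall_subset_of_agree_inside {G H : SimpleGraph V} {C : Set V} {r : ℕ} {u : V}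
    (hGH : ∀ x ∈ C, ∀ y ∈ C, G.Adj x y → H.Adj x y) (hC : closedBall G r u ⊆ C) :
    closedBall G r u ⊆ closedBall H r u := by
  induction r with
  | zero =>
    intro x hx
    rw [mem_closedBall_zero] at hx ⊢
    exact hx
  | succ r ih =>
    have hsub := closedBall_mono_radius (G := G) r.le_succ u
    intro x hx
    have hxC := hC hx
    rw [mem_closedBall_succ] at hx ⊢
    rcases hx with rfl | ⟨y, hxy, hy⟩
    · exact Or.inl rfl
    · exact Or.inr ⟨y, hGH x hxC y (hC (hsub hy)) hxy, ih (hsub.trans hC) hy⟩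

/-- If two graphs agree on the pairs touching `B` and a ball of the first is contained in `B`, then
it is also a ball of the second. -/
lemma closedBall_eq_of_agree_touching {G H : SimpleGraph V} {B : Set V} {r : ℕ} {u : V}
    (hGH : ∀ x ∈ B, ∀ y, G.Adj x y ↔ H.Adj x y) (hB : closedBall G r u ⊆ B) :
    closedBall H r u = closedBall G r u := by
  induction r with
  | zero =>
    ext x
    rw [mem_closedBall_zero, mem_closedBall_zero]
  | succ r ih =>
    have hsub := closedBall_mono_radius (G := G) r.le_succ u
    have ih' := ih (hsub.trans hB)
    ext x
    rw [mem_closedBall_succ, mem_closedBall_succ, ih']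
    refine or_congr Iff.rfl (exists_congr fun y => and_congr_left fun hy => ?_)
    rw [G.adj_comm, H.adj_comm, hGH y (hB (hsub hy))]

/-- Whether the ball equals `B` is decided by the pairs that touch `B`, and resampling inside the
complement leaves these alone. -/
lemma closedBall_resample_eq_iff {G H : SimpleGraph V} {B : Set V} {r : ℕ} {u : V} :
    closedBall (resampleGraph G H Bᶜ) r u = B ↔ closedBall G r u = B := by
  have h : ∀ x ∈ B, ∀ y, (resampleGraph G H Bᶜ).Adj x y ↔ G.Adj x y := by
    intro x hx y
    simp [resampleGraph, hx]
  constructor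
  · intro hb
    rw [closedBall_eq_of_agree_touching h hb.le, hb]
  · intro hb
    rw [closedBall_eq_of_agree_touching (fun x hx y => (h x hx y).symm) hb.le, hb]

/-- The last step of a shortest path to `x` starts at a vertex which can be reached without
visiting `x`. -/
lemma exists_adj_mem_closedBall {G H : SimpleGraph V} {r : ℕ} {u x : V}
    (hGH : ∀ y ≠ x, ∀ z ≠ x, G.Adj y z → H.Adj y z)
    (hx : x ∈ closedBall G (r + 1) u) : x = u ∨ ∃ y, G.Adj x y ∧ y ∈ closedBall H r u := by
  induction r with
  | zero =>
    rw [mem_closedBall_succ] at hx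
    simpa only [mem_closedBall_zero] using hx
  | succ r ih =>
    by_cases hx' : x ∈ closedBall G (r + 1) u
    · exact (ih hx').imp_right fun ⟨y, hy, hyr⟩ =>
        ⟨y, hy, closedBall_mono_radius r.le_succ u hyr⟩
    · rw [mem_closedBall_succ] at hx
      refine hx.imp_right fun ⟨y, hy, hyr⟩ => ⟨y, hy, ?_⟩
      refine closedBall_subset_of_agree_inside (C := {x}ᶜ) hGH ?_ hyr
      intro z hz hzx
      rw [Set.mem_singleton_iff] at hzx
      exact hx' (hzx ▸ hz)

/-- The decision of a factor at `v` depends only on the graph and the labels inside a set containing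
the ball around `v`. -/
lemma Factor.mem_select_congr {r : ℕ} (f : Factor r) [Finite V] {G H : SimpleGraph V}
    {x y : V → I} {D : Set V} {v : V}
    (hGH : ∀ a ∈ D, ∀ b ∈ D, G.Adj a b ↔ H.Adj a b) (hxy : ∀ a ∈ D, x a = y a)
    (hG : closedBall G r v ⊆ D) (hH : closedBall H r v ⊆ D) :
    v ∈ f.select G x ↔ v ∈ f.select H y := by
  have hball : closedBall G r v = closedBall H r v := by
    refine subset_antisymm (closedBall_subset_of_agree_inside (C := D) ?_ hG)
      (closedBall_subset_of_agree_inside (C := D) ?_ hH)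
    · exact fun a ha b hb h => (hGH a ha b hb).1 h
    · exact fun a ha b hb h => (hGH a ha b hb).2 h
  let φ : (rootedBall G r v).graph ≃g (rootedBall H r v).graph :=
    { toEquiv := Equiv.setCongr hball
      map_rel_iff' := by
        rintro ⟨a, ha⟩ ⟨b, hb⟩
        exact (hGH a (hG ha) b (hG hb)).symm }
  have key := f.invariant (rootedBall G r v) (rootedBall H r v) φ rfl (fun u => x u.1)
  have hlab : (fun u : (rootedBall G r v).V => x u.1) ∘ φ.symm = fun u => y u.1 := by
    funext u
    exact hxy _ (hH u.2)
  rw [hlab] at key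
  show f.toFun _ = true ↔ f.toFun _ = true
  rw [key]

end BallLemmas

/-! ### Merging two independent samples into one of the same law -/

section Merging

variable {α β ι : Type*} [MeasurableSpace α] [MeasurableSpace β]

lemma measurePreserving_prod_middle_swap {γ δ : Type*} [MeasurableSpace γ] [MeasurableSpace δ]
    (a : Measure α) (b : Measure β) (c : Measure γ) (d : Measure δ)
    [IsProbabilityMeasure a] [IsProbabilityMeasure b] [IsProbabilityMeasure c]
    [IsProbabilityMeasure d] :
    MeasurePreserving (fun z : (α × β) × (γ × δ) => ((z.1.1, z.2.1), (z.1.2, z.2.2)))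
      ((a.prod b).prod (c.prod d)) ((a.prod c).prod (b.prod d)) := by
  have h1 := measurePreserving_prodAssoc a b (c.prod d)
  have h2 := (MeasurePreserving.id a).prod (measurePreserving_prodAssoc b c d).symm
  have h3 := (MeasurePreserving.id a).prod
    ((Measure.measurePreserving_swap (μ := b) (ν := c)).prod (MeasurePreserving.id d))
  have h4 := (MeasurePreserving.id a).prod (measurePreserving_prodAssoc c b d)
  have h5 := (measurePreserving_prodAssoc a c (b.prod d)).symm
  exact h5.comp (h4.comp (h3.comp (h2.comp h1)))

lemma measurePreserving_merge_prod {a : Measure α} {b : Measure β} [IsProbabilityMeasure a]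
    [IsProbabilityMeasure b] {m : α × α → α} {m' : β × β → β}
    (hm : MeasurePreserving m (a.prod a) a) (hm' : MeasurePreserving m' (b.prod b) b) :
    MeasurePreserving (fun z : (α × β) × (α × β) => (m (z.1.1, z.2.1), m' (z.1.2, z.2.2)))
      ((a.prod b).prod (a.prod b)) (a.prod b) :=
  (hm.prod hm').comp (measurePreserving_prod_middle_swap a b a b)

/-- Lets a merging map descend along a measure preserving image: from independent coins to random
sets, and from random edge sets to random graphs. -/
lemma measurePreserving_merge_of_semiconj {a : Measure α} {b : Measure β} [IsProbabilityMeasure a]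
    [IsProbabilityMeasure b] {φ : α → β} (hφ : MeasurePreserving φ a b) {m : α × α → α}
    (hm : MeasurePreserving m (a.prod a) a) {m' : β × β → β} (hm' : Measurable m')
    (h : ∀ x y, m' (φ x, φ y) = φ (m (x, y))) :
    MeasurePreserving m' (b.prod b) b := by
  refine ⟨hm', ?_⟩
  have hφφ := hφ.prod hφ
  have hcomp : m' ∘ Prod.map φ φ = φ ∘ m := by
    funext ⟨x, y⟩
    exact h x y
  rw [← hφφ.map_eq, Measure.map_map hm' hφφ.measurable, hcomp]
  exact (hφ.comp hm).map_eq

/-- The source of all concrete merging maps: the choice of copy at each coordinate is deterministic,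
so independence and the marginals survive. -/
lemma measurePreserving_piecewise_infinitePi {X : ι → Type*} [∀ i, MeasurableSpace (X i)]
    (μ : ∀ i, Measure (X i)) [∀ i, IsProbabilityMeasure (μ i)] (A : Set ι)
    [DecidablePred (· ∈ A)] :
    MeasurePreserving
      (fun z : (∀ i, X i) × (∀ i, X i) => fun i => if i ∈ A then z.2 i else z.1 i)
      ((Measure.infinitePi μ).prod (Measure.infinitePi μ)) (Measure.infinitePi μ) := by
  have hmeas : Measurable
      (fun z : (∀ i, X i) × (∀ i, X i) => fun i => if i ∈ A then z.2 i else z.1 i) := by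
    refine measurable_pi_lambda _ fun i => ?_
    by_cases hi : i ∈ A <;> simp only [hi, if_true, if_false] <;> fun_prop
  refine ⟨hmeas, Measure.eq_infinitePi _ fun s t ht => ?_⟩
  classical
  rw [Measure.map_apply hmeas (.pi s.countable_toSet fun i _ => ht i)]
  have hpre : (fun z : (∀ i, X i) × (∀ i, X i) => fun i => if i ∈ A then z.2 i else z.1 i) ⁻¹'
      (Set.pi s t) = (Set.pi ((s.filter (· ∉ A) : Finset ι) : Set ι) t) ×ˢ
        (Set.pi ((s.filter (· ∈ A) : Finset ι) : Set ι) t) := by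
    ext ⟨x, y⟩
    simp only [Set.mem_preimage, Set.mem_pi, Finset.mem_coe, Set.mem_prod, Finset.mem_filter]
    constructor
    · intro h
      refine ⟨fun i hi => ?_, fun i hi => ?_⟩
      · simpa [hi.2] using h i hi.1
      · simpa [hi.2] using h i hi.1
    · rintro ⟨h1, h2⟩ i hi
      by_cases hA : i ∈ A
      · simpa [hA] using h2 i ⟨hi, hA⟩
      · simpa [hA] using h1 i ⟨hi, hA⟩
  rw [hpre, Measure.prod_prod, Measure.infinitePi_pi _ fun i _ => ht i,
    Measure.infinitePi_pi _ fun i _ => ht i, mul_comm, Finset.prod_filter_mul_prod_filter_not]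

/-- The whole space, as a trivial spanning sequence of square cylinders. -/
def spanningSquareCylinders (κ : ι → Measure α) [∀ i, IsProbabilityMeasure (κ i)] :
    (Measure.infinitePi κ).FiniteSpanningSetsIn
      (squareCylinders fun _ : ι => {s : Set α | MeasurableSet s}) where
  set _ := Set.univ
  set_mem _ := ⟨∅, fun _ => Set.univ, by simp, by simp⟩
  finite _ := measure_lt_top _ _
  spanning := Set.iUnion_const _

lemma prod_measure_ite_univ [DecidableEq ι] (κ : ι → Measure α) [∀ i, IsProbabilityMeasure (κ i)]
    {u w : Finset ι} (huw : u ⊆ w) (q : ι → Set α) :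
    ∏ i ∈ w, κ i (if i ∈ u then q i else Set.univ) = ∏ i ∈ u, κ i (q i) := by
  rw [← Finset.prod_subset huw]
  · exact Finset.prod_congr rfl fun i hi => by rw [if_pos hi]
  · intro i _ hi
    rw [if_neg hi, measure_univ]

/-- Both laws agree on products of square cylinders, a generating π-system. The two finite index
sets are padded by the whole space to their union, so that the preimage is a single cylinder. -/
lemma measurePreserving_unzip_infinitePi (μ : ι → Measure α) (ν : ι → Measure β)
    [∀ i, IsProbabilityMeasure (μ i)] [∀ i, IsProbabilityMeasure (ν i)] :
    MeasurePreserving (fun z : ι → α × β => ((fun i => (z i).1), (fun i => (z i).2)))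
      (Measure.infinitePi fun i => (μ i).prod (ν i))
      ((Measure.infinitePi μ).prod (Measure.infinitePi ν)) := by
  have hmeas : Measurable (fun z : ι → α × β => ((fun i => (z i).1), (fun i => (z i).2))) := by
    fun_prop
  refine ⟨hmeas, ?_⟩
  symm
  refine Measure.prod_eq_generateFrom generateFrom_squareCylinders generateFrom_squareCylinders
    (isPiSystem_squareCylinders (fun _ => MeasurableSpace.isPiSystem_measurableSet) (by simp))
    (isPiSystem_squareCylinders (fun _ => MeasurableSpace.isPiSystem_measurableSet) (by simp))
    (spanningSquareCylinders μ) (spanningSquareCylinders ν) ?_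
  rintro _ ⟨s, t, ht, rfl⟩ _ ⟨s', t', ht', rfl⟩
  simp only [Set.mem_pi, Set.mem_univ, Set.mem_ofPred_eq, true_implies] at ht ht'
  classical
  rw [Measure.map_apply hmeas ((MeasurableSet.pi s.countable_toSet fun i _ => ht i).prod
    (MeasurableSet.pi s'.countable_toSet fun i _ => ht' i))]
  have hpre : (fun z : ι → α × β => ((fun i => (z i).1), (fun i => (z i).2))) ⁻¹'
      (Set.pi (s : Set ι) t ×ˢ Set.pi (s' : Set ι) t') =
      Set.pi ((s ∪ s' : Finset ι) : Set ι) (fun i =>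
        (if i ∈ s then t i else Set.univ) ×ˢ (if i ∈ s' then t' i else Set.univ)) := by
    ext z
    simp only [Set.mem_preimage, Set.mem_prod, Set.mem_pi, Finset.mem_coe, Finset.mem_union]
    constructor
    · rintro ⟨h1, h2⟩ i -
      refine ⟨?_, ?_⟩ <;> split_ifs with hi
      exacts [h1 i hi, trivial, h2 i hi, trivial]
    · intro h
      refine ⟨fun i hi => ?_, fun i hi => ?_⟩
      · simpa [hi] using (h i (Or.inl hi)).1
      · simpa [hi] using (h i (Or.inr hi)).2
  rw [hpre, Measure.infinitePi_pi, Measure.infinitePi_pi _ fun i _ => ht i,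
    Measure.infinitePi_pi _ fun i _ => ht' i]
  · simp only [Measure.prod_prod, Finset.prod_mul_distrib]
    rw [prod_measure_ite_univ μ Finset.subset_union_left,
      prod_measure_ite_univ ν Finset.subset_union_right]
  · intro i _
    refine MeasurableSet.prod ?_ ?_ <;> split_ifs
    exacts [ht i, .univ, ht' i, .univ]

lemma measurePreserving_merge_infinitePi {μ : Measure α} [IsProbabilityMeasure μ]
    {m : α × α → α} (hm : MeasurePreserving m (μ.prod μ) μ) :
    MeasurePreserving (fun z : (ι → α) × (ι → α) => fun i => m (z.1 i, z.2 i))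
      ((Measure.infinitePi fun _ : ι => μ).prod (Measure.infinitePi fun _ : ι => μ))
      (Measure.infinitePi fun _ : ι => μ) := by
  have hmeas : Measurable (fun z : (ι → α) × (ι → α) => fun i => m (z.1 i, z.2 i)) := by
    have := hm.measurable
    fun_prop
  have hz := measurePreserving_unzip_infinitePi (ι := ι) (fun _ => μ) (fun _ => μ)
  refine ⟨hmeas, ?_⟩
  rw [← hz.map_eq, Measure.map_map hmeas hz.measurable]
  have := Measure.infinitePi_map_pi (fun _ : ι => μ.prod μ) (f := fun _ => m)
    (fun _ => hm.measurable)
  simp only [hm.map_eq] at this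
  exact this

end Merging

/-! ### Merging of percolation sets, graphs, labels and whole coupling samples -/

section ConcreteMerging

variable {ι : Type*} {V : Type}

lemma measurePreserving_merge_setBernoulli [Countable ι] (u : Set ι) (p : I) (A : Set ι) :
    MeasurePreserving (fun z : Set ι × Set ι => (z.1 \ A) ∪ (z.2 ∩ A))
      ((setBernoulli u p).prod (setBernoulli u p)) (setBernoulli u p) := by
  classical
  have hφ : MeasurePreserving (fun q : ι → Prop => {i | q i})
      (Measure.infinitePi fun i : ι => unitInterval.toNNReal p • Measure.dirac (i ∈ u) +
        unitInterval.toNNReal (unitInterval.symm p) • Measure.dirac False) (setBernoulli u p) :=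
    ⟨measurable_setOfPred, (setBernoulli_eq_map u p).symm⟩
  refine measurePreserving_merge_of_semiconj hφ (measurePreserving_piecewise_infinitePi _ A) ?_ ?_
  · refine measurable_set_iff.2 fun a => ?_
    by_cases ha : a ∈ A
    · simpa [ha, Function.comp_def] using (measurable_set_mem a).comp measurable_snd
    · simpa [ha, Function.comp_def] using (measurable_set_mem a).comp measurable_fst
  · intro x y
    ext i
    by_cases hi : i ∈ A <;> simp [hi]

lemma measurable_resampleGraph [Countable V] (C : Set V) :
    Measurable (fun z : SimpleGraph V × SimpleGraph V => resampleGraph z.1 z.2 C) := by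
  refine SimpleGraph.measurable_iff_adj.2 fun u v => ?_
  have h : ∀ a b : V, Measurable fun G : SimpleGraph V => G.Adj a b :=
    fun a b => SimpleGraph.measurable_iff_adj.1 measurable_id a b
  have h1 : Measurable fun z : SimpleGraph V × SimpleGraph V => z.1.Adj u v :=
    (h u v).comp measurable_fst
  have h2 : Measurable fun z : SimpleGraph V × SimpleGraph V => z.2.Adj u v :=
    (h u v).comp measurable_snd
  by_cases huv : u ∈ C ∧ v ∈ C
  · simpa only [resampleGraph, huv, true_and, not_true_eq_false, false_and, or_false, and_self]
      using h2
  · simpa only [resampleGraph, huv, true_and, not_false_eq_true, false_and, false_or]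
      using h1

lemma measurePreserving_fromEdgeSet [Countable V] (q : I) :
    MeasurePreserving SimpleGraph.fromEdgeSet (setBernoulli (Sym2.diagSetᶜ : Set (Sym2 V)) q)
      (SimpleGraph.binomialRandom V q) :=
  ⟨SimpleGraph.measurable_fromEdgeSet, (SimpleGraph.binomialRandom_eq_map V q).symm⟩

lemma measurePreserving_resampleGraph [Countable V] (q : I) (C : Set V) :
    MeasurePreserving (fun z : SimpleGraph V × SimpleGraph V => resampleGraph z.1 z.2 C)
      ((SimpleGraph.binomialRandom V q).prod (SimpleGraph.binomialRandom V q))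
      (SimpleGraph.binomialRandom V q) := by
  refine measurePreserving_merge_of_semiconj (measurePreserving_fromEdgeSet q)
    (measurePreserving_merge_setBernoulli Sym2.diagSetᶜ q {e | ∀ v ∈ e, v ∈ C})
    (measurable_resampleGraph C) ?_
  intro x y
  ext u v
  by_cases huv : u ∈ C ∧ v ∈ C
  · simp [resampleGraph, huv]
  · have h2 : u ∈ C → v ∉ C := fun h h' => huv ⟨h, h'⟩
    simp only [resampleGraph, huv, SimpleGraph.fromEdgeSet_adj, Set.mem_union, Set.mem_sdiff,
      Set.mem_inter_iff, Set.mem_ofPred_eq, Sym2.mem_iff, forall_eq_or_imp, forall_eq]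
    simp

lemma measurePreserving_resampleLabel [Fintype V] (C : Set V) :
    MeasurePreserving (fun z : (V → I) × (V → I) => resampleLabel z.1 z.2 C)
      ((volume : Measure (V → I)).prod volume) volume := by
  classical
  have h := measurePreserving_piecewise_infinitePi (fun _ : V => (volume : Measure I)) C
  rw [Measure.infinitePi_eq_pi] at h
  have heq : (fun z : (V → I) × (V → I) => resampleLabel z.1 z.2 C) =
      fun z i => if i ∈ C then z.2 i else z.1 i := by
    funext z i
    by_cases hi : i ∈ C <;> simp [resampleLabel, hi]
  rw [heq]
  exact h

/-- Resample the edges and labels inside `C`. -/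
noncomputable def resample (C : Set V) (z : (SimpleGraph V × (V → I)) × (SimpleGraph V × (V → I))) :
    SimpleGraph V × (V → I) :=
  (resampleGraph z.1.1 z.2.1 C, resampleLabel z.1.2 z.2.2 C)

instance (n : ℕ) (q : I) : IsProbabilityMeasure (labelledER n q) := by
  unfold labelledER
  infer_instance

instance (n : ℕ) (q p : I) : IsProbabilityMeasure (couplingMeasure n q p) := by
  unfold couplingMeasure
  infer_instance

lemma measurePreserving_resample (n : ℕ) (q : I) (C : Set (Fin n)) :
    MeasurePreserving (resample C) ((labelledER n q).prod (labelledER n q)) (labelledER n q) :=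
  measurePreserving_merge_prod (measurePreserving_resampleGraph q C)
    (measurePreserving_resampleLabel C)

/-- Take the randomness inside `C` from the second sample, and all other randomness from the
first. -/
noncomputable def mergeSample {n : ℕ} (C : Set (Fin n)) (z : Sample n × Sample n) : Sample n :=
  ((resample C (z.1.1.1, z.2.1.1), (z.1.1.2 \ C) ∪ (z.2.1.2 ∩ C)),
    fun t => resample C (z.1.2 t, z.2.2 t))

lemma measurePreserving_mergeSample (n : ℕ) (q p : I) (C : Set (Fin n)) :
    MeasurePreserving (mergeSample C) ((couplingMeasure n q p).prod (couplingMeasure n q p))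
      (couplingMeasure n q p) :=
  measurePreserving_merge_prod
    (measurePreserving_merge_prod (measurePreserving_resample n q C)
      (measurePreserving_merge_setBernoulli Set.univ p C))
    (measurePreserving_merge_infinitePi (measurePreserving_resample n q C))

end ConcreteMerging

/-! ### Edge probabilities of the binomial random graph -/

section EdgeProbabilities

variable {V : Type} [Countable V]

/-- The probability that a binomial random graph avoids a given set of edges. -/
lemma binomialRandom_real_forall_notMem (q : I) (D : Finset (Sym2 V))
    (hD : ∀ e ∈ D, ¬ e.IsDiag) :
    (SimpleGraph.binomialRandom V q).real {G | ∀ e ∈ D, e ∉ G.edgeSet} =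
      (1 - (q : ℝ)) ^ D.card := by
  have h := (measurePreserving_fromEdgeSet (V := V) q).comp
    (⟨measurable_setOfPred, (setBernoulli_eq_map _ q).symm⟩ : MeasurePreserving
      (fun r : Sym2 V → Prop => {i | r i}) _ (setBernoulli (Sym2.diagSetᶜ : Set (Sym2 V)) q))
  have hms : MeasurableSet {G : SimpleGraph V | ∀ e ∈ D, e ∉ G.edgeSet} := by
    have : {G : SimpleGraph V | ∀ e ∈ D, e ∉ G.edgeSet} =
        ⋂ e ∈ D, SimpleGraph.edgeSet ⁻¹' {s | e ∉ s} := by ext; simp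
    rw [this]
    exact Finset.measurableSet_biInter _ fun e _ =>
      SimpleGraph.measurable_edgeSet (measurableSet_notMem e)
  rw [measureReal_def, ← h.measure_preimage hms.nullMeasurableSet]
  have hpre : (SimpleGraph.fromEdgeSet ∘ fun r : Sym2 V → Prop => {i | r i}) ⁻¹'
      {G : SimpleGraph V | ∀ e ∈ D, e ∉ G.edgeSet} =
        Set.pi (D : Set (Sym2 V)) fun _ => {False} := by
    ext r
    simp only [Set.mem_preimage, Function.comp, Set.mem_ofPred_eq, Set.mem_pi, Finset.mem_coe,
      SimpleGraph.edgeSet_fromEdgeSet, Set.mem_singleton_iff]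
    refine forall₂_congr fun e he => ?_
    have := hD e he
    simp [this]
  rw [hpre, Measure.infinitePi_pi]
  · rw [Finset.prod_congr rfl
      (g := fun _ => (unitInterval.toNNReal (unitInterval.symm q) : ENNReal))]
    · simp
    · intro e he
      have := hD e he
      rw [Measure.add_apply, Measure.smul_apply, Measure.smul_apply]
      simp [this]
  · intro e _
    exact .singleton _

lemma binomialRandom_real_adj (q : I) {x y : V} (hxy : x ≠ y) :
    (SimpleGraph.binomialRandom V q).real {G | G.Adj x y} = q := by
  have h := binomialRandom_real_forall_notMem q {s(x, y)} (by simpa using hxy)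
  have hms : MeasurableSet {G : SimpleGraph V | G.Adj x y} :=
    measurableSet_setOfPred.2 (SimpleGraph.measurable_iff_adj.1 measurable_id x y)
  have hc : {G : SimpleGraph V | ∀ e ∈ ({s(x, y)} : Finset (Sym2 V)), e ∉ G.edgeSet} =
      {G | G.Adj x y}ᶜ := by
    ext G
    simp
  rw [hc, probReal_compl_eq_one_sub hms] at h
  simp only [Finset.card_singleton, pow_one] at h
  linarith

end EdgeProbabilities

/-! ### Measurability of the selected and coupled sets -/

section Measurability

instance {V : Type} [Finite V] : DiscreteMeasurableSpace (SimpleGraph V) :=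
  have : MeasurableSingletonClass (SimpleGraph V) := ⟨fun G => by
    have := SimpleGraph.measurable_edgeSet (measurableSet_singleton G.edgeSet)
    convert this
    ext H
    simp⟩
  inferInstance

variable {r : ℕ} (f : Factor r)

lemma Factor.measurableSet_mem_select {V : Type} [Finite V] (v : V) :
    MeasurableSet {z : SimpleGraph V × (V → I) | v ∈ f.select z.1 z.2} := by
  have h : Measurable (fun z : SimpleGraph V × (V → I) =>
      f.toFun ⟨rootedBall z.1 r v, fun u => z.2 u.1⟩) := by
    refine measurable_from_prod_countable_right fun G => ?_
    -- Each summand includes measurably, because the `σ`-algebra of the disjoint union is an infimum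
    -- over its summands.
    have hmk : Measurable (fun x : (rootedBall G r v).V → I =>
        (⟨rootedBall G r v, x⟩ : LabelledGraph r)) :=
      Measurable.of_le_map (iInf_le _ _)
    refine f.measurable_toFun.comp (hmk.comp ?_)
    exact measurable_pi_lambda _ fun u => measurable_pi_apply _
  exact h (measurableSet_singleton true)

lemma measurable_coupled (n t : ℕ) :
    Measurable fun ω : Sample n => (coupledGraph ω t, coupledLabel ω t) := by
  have h1 : Measurable (fun z : Set (Fin n) × (SimpleGraph (Fin n) × SimpleGraph (Fin n)) =>
      resampleGraph z.2.1 z.2.2 z.1) :=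
    .of_discrete
  refine Measurable.prodMk ?_ ?_
  · exact h1.comp (f := fun ω : Sample n => (ω.1.2, (ω.1.1.1, (ω.2 t).1))) (by fun_prop)
  · have h2 : Measurable (fun z : Set (Fin n) × ((Fin n → I) × (Fin n → I)) =>
        resampleLabel z.2.1 z.2.2 z.1) := by
      refine measurable_from_prod_countable_right fun S => ?_
      refine measurable_pi_lambda _ fun v => ?_
      by_cases hv : v ∈ S <;> simp only [resampleLabel, hv, if_true, if_false] <;> fun_prop
    exact h2.comp (f := fun ω : Sample n => (ω.1.2, (ω.1.1.2, (ω.2 t).2))) (by fun_prop)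

lemma Factor.measurableSet_mem_coupledSet {n : ℕ} (t : ℕ) (v : Fin n) :
    MeasurableSet {ω : Sample n | v ∈ f.coupledSet ω t} :=
  measurable_coupled n t (f.measurableSet_mem_select v)

end Measurability

/-- A random graph `U` on a probability space, together with measure preserving maps which combine
two independent samples: inside `C` the graph is taken from the second sample, and all other pairs
are taken from the first. -/
structure Resampling {Ω : Type*} [MeasurableSpace Ω] {V : Type} [Finite V] (P : Measure Ω)
    (U : Ω → SimpleGraph V) (m : Set V → Ω × Ω → Ω) : Prop where
  measurable_graph : Measurable U
  measurePreserving : ∀ C, MeasurePreserving (m C) (P.prod P) P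
  graph_eq : ∀ C z, U (m C z) = resampleGraph (U z.1) (U z.2) C

/-- A family of events, indexed by the vertices, which depend only on the randomness inside the ball
of radius `r`. -/
structure IsLocalFamily {Ω : Type*} {V : Type} (U : Ω → SimpleGraph V)
    (m : Set V → Ω × Ω → Ω) (r : ℕ) (F : V → Set Ω) : Prop where
  outside : ∀ C u z, closedBall (U z.1) r u ⊆ Cᶜ → closedBall (U (m C z)) r u ⊆ Cᶜ →
    (m C z ∈ F u ↔ z.1 ∈ F u)
  inside : ∀ C u z, closedBall (U z.2) r u ⊆ C → closedBall (U (m C z)) r u ⊆ C →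
    (m C z ∈ F u ↔ z.2 ∈ F u)

/-! ### Ball growth, decorrelation of local events and the variance bound -/

namespace Resampling

variable {Ω : Type*} [MeasurableSpace Ω] {V : Type} [Fintype V] {P : Measure Ω}
  {U : Ω → SimpleGraph V} {m : Set V → Ω × Ω → Ω}

lemma measurableSet_graph (h : Resampling P U m) (p : SimpleGraph V → Prop) :
    MeasurableSet {ω | p (U ω)} :=
  h.measurable_graph (MeasurableSet.of_discrete (s := {G | p G}))

lemma measureReal_preimage (h : Resampling P U m) (C : Set V) {A : Set Ω} (hA : MeasurableSet A) :
    (P.prod P).real (m C ⁻¹' A) = P.real A :=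
  congrArg ENNReal.toReal ((h.measurePreserving C).measure_preimage hA.nullMeasurableSet)

variable [IsProbabilityMeasure P]

/-- A shortest path from `u` reaches `x` by an edge from some `y` that lies in the ball even when
`x` is avoided. Merging along `{x}ᶜ` takes the edges at `x` from one sample and the rest from an
independent one, so the two conditions on `y` have a product probability. -/
lemma prob_mem_closedBall_succ_le (h : Resampling P U m) {δ : ℝ}
    (hδ : ∀ x y, P.real {ω | (U ω).Adj x y} ≤ δ) (r : ℕ) (u x : V) [Decidable (x = u)] :
    P.real {ω | x ∈ closedBall (U ω) (r + 1) u} ≤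
      (if x = u then 1 else 0) + δ * ∑ y, P.real {ω | y ∈ closedBall (U ω) r u} := by
  have hδ0 : 0 ≤ δ := measureReal_nonneg.trans (hδ x x)
  split_ifs with hxu
  · have : 0 ≤ δ * ∑ y, P.real {ω | y ∈ closedBall (U ω) r u} :=
      mul_nonneg hδ0 (Finset.sum_nonneg fun y _ => measureReal_nonneg)
    linarith [measureReal_le_one (μ := P) (s := {ω | x ∈ closedBall (U ω) (r + 1) u})]
  rw [zero_add, ← h.measureReal_preimage {x}ᶜ
    (h.measurableSet_graph fun G => x ∈ closedBall G (r + 1) u)]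
  calc (P.prod P).real (m {x}ᶜ ⁻¹' {ω | x ∈ closedBall (U ω) (r + 1) u})
      ≤ (P.prod P).real (⋃ y ∈ (Finset.univ : Finset V),
          {ω | (U ω).Adj x y} ×ˢ {ω | y ∈ closedBall (U ω) r u}) := by
        refine measureReal_mono ?_ (measure_ne_top _ _)
        intro z hz
        simp only [Set.mem_preimage, Set.mem_ofPred_eq, h.graph_eq] at hz
        have := exists_adj_mem_closedBall (H := U z.2) (fun y hy w hw hyw => ?_) hz
        · rcases this.resolve_left hxu with ⟨y, hxy, hy⟩
          simp only [Finset.mem_univ, Set.iUnion_true, Set.mem_iUnion, Set.mem_prod,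
            Set.mem_ofPred_eq]
          refine ⟨y, ?_, hy⟩
          simpa [resampleGraph] using hxy
        · simpa [resampleGraph, hy, hw] using hyw
    _ ≤ ∑ y, (P.prod P).real ({ω | (U ω).Adj x y} ×ˢ {ω | y ∈ closedBall (U ω) r u}) :=
        measureReal_biUnion_finset_le _ _
    _ ≤ ∑ y, δ * P.real {ω | y ∈ closedBall (U ω) r u} := by
        refine Finset.sum_le_sum fun y _ => ?_
        rw [measureReal_prod_prod]
        exact mul_le_mul_of_nonneg_right (hδ x y) measureReal_nonneg
    _ = _ := (Finset.mul_sum _ _ _).symm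

/-- The expected size of a ball is at most that of a ball in a tree of branching number
`|V| δ`. -/
lemma sum_prob_mem_closedBall_le (h : Resampling P U m) {δ : ℝ}
    (hδ : ∀ x y, P.real {ω | (U ω).Adj x y} ≤ δ) (r : ℕ) (u : V) :
    ∑ x, P.real {ω | x ∈ closedBall (U ω) r u} ≤
      ∑ j ∈ Finset.range (r + 1), (Fintype.card V * δ) ^ j := by
  classical
  have hδ0 : 0 ≤ δ := measureReal_nonneg.trans (hδ u u)
  induction r with
  | zero =>
    simp only [mem_closedBall_zero]
    rw [Finset.sum_eq_single u] <;> simp +contextual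
  | succ r ih =>
    calc ∑ x, P.real {ω | x ∈ closedBall (U ω) (r + 1) u}
        ≤ ∑ x : V, ((if x = u then 1 else 0) +
            δ * ∑ y, P.real {ω | y ∈ closedBall (U ω) r u}) :=
          Finset.sum_le_sum fun x _ => h.prob_mem_closedBall_succ_le hδ r u x
      _ = 1 + (Fintype.card V * δ) * ∑ y, P.real {ω | y ∈ closedBall (U ω) r u} := by
          rw [Finset.sum_add_distrib]
          simp [mul_assoc]
      _ ≤ 1 + (Fintype.card V * δ) * ∑ j ∈ Finset.range (r + 1), (Fintype.card V * δ) ^ j := by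
          gcongr
      _ = ∑ j ∈ Finset.range (r + 1 + 1), (Fintype.card V * δ) ^ j := by
          rw [Finset.sum_range_succ' _ (r + 1), Finset.mul_sum, pow_zero, add_comm]
          simp only [pow_succ']

lemma measureReal_eq_sum_closedBall (h : Resampling P U m) (r : ℕ) (u : V) (A : Set Ω) :
    P.real A = ∑ B : Set V, P.real ({ω | closedBall (U ω) r u = B} ∩ A) := by
  have key := sum_measureReal_preimage_singleton (μ := P.restrict A) (Finset.univ : Finset (Set V))
    (f := fun ω => closedBall (U ω) r u)
    (fun B _ => h.measurableSet_graph fun G => closedBall G r u = B)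
  simp only [Finset.coe_univ, Set.preimage_univ, measureReal_restrict_apply_univ] at key
  rw [← key]
  refine Finset.sum_congr rfl fun B _ => ?_
  exact measureReal_restrict_apply (h.measurableSet_graph fun G => closedBall G r u = B)

/-- Local events at two vertices are almost uncorrelated unless their balls are likely to
intersect. -/
lemma prob_inter_le (h : Resampling P U m) {r : ℕ} {F : V → Set Ω} (hF : IsLocalFamily U m r F)
    (hFm : ∀ u, MeasurableSet (F u)) (u v : V) :
    P.real (F u ∩ F v) ≤ P.real (F u) * P.real (F v) +
      ∑ w, P.real {ω | w ∈ closedBall (U ω) r u} * P.real {ω | w ∈ closedBall (U ω) r v} +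
      P.real {ω | v ∈ closedBall (U ω) (r + r) u} := by
  classical
  set E : Set V → Set Ω := fun B => {ω | closedBall (U ω) r u = B} with hE
  set J : Set V → Set Ω := fun B => {ω | ∃ w ∈ B, w ∈ closedBall (U ω) r v} with hJ
  have hEm : ∀ B, MeasurableSet (E B) := fun B =>
    h.measurableSet_graph fun G => closedBall G r u = B
  have hJm : ∀ B, MeasurableSet (J B) := fun B =>
    h.measurableSet_graph fun G => ∃ w ∈ B, w ∈ closedBall G r v
  -- Merge along `Bᶜ`: the first sample fixes the ball `B` of `u` and the event `F u`, the second
  -- decides `F v` as long as the ball of `v` misses `B`. The two error terms are the failures of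
  -- this: the ball of `v` meets `B` in the independent second sample (a product) or in the merged
  -- sample itself.
  have hB : ∀ B, P.real (E B ∩ (F u ∩ F v)) ≤ P.real (E B ∩ F u) * P.real (F v) +
      P.real (E B) * P.real (J B) + P.real (E B ∩ J B) := by
    intro B
    rw [← h.measureReal_preimage Bᶜ ((hEm B).inter ((hFm u).inter (hFm v))),
      ← h.measureReal_preimage Bᶜ ((hEm B).inter (hJm B)), ← measureReal_prod_prod,
      ← measureReal_prod_prod]
    refine le_trans (measureReal_mono ?_) ((measureReal_union_le _ _).trans
      (add_le_add_left (measureReal_union_le _ _) _))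
    intro z hz
    obtain ⟨hz1, hzu, hzv⟩ := hz
    by_cases hJ1 : m Bᶜ z ∈ J B
    · exact Or.inr ⟨hz1, hJ1⟩
    left
    have hz1' : closedBall (U (m Bᶜ z)) r u = B := hz1
    have hz0 : closedBall (U z.1) r u = B := by
      rw [h.graph_eq, closedBall_resample_eq_iff] at hz1'
      exact hz1'
    by_cases hJ2 : z.2 ∈ J B
    · exact Or.inr ⟨hz0, hJ2⟩
    left
    refine ⟨⟨hz0, ?_⟩, ?_⟩
    · refine (hF.outside Bᶜ u z ?_ ?_).1 hzu <;> rw [compl_compl]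
      exacts [hz0.le, hz1'.le]
    · refine (hF.inside Bᶜ v z ?_ ?_).1 hzv
      · exact fun w hw hwB => hJ2 ⟨w, hwB, hw⟩
      · exact fun w hw hwB => hJ1 ⟨w, hwB, hw⟩
  have hmid : ∑ B, P.real (E B) * P.real (J B) ≤
      ∑ w, P.real {ω | w ∈ closedBall (U ω) r u} * P.real {ω | w ∈ closedBall (U ω) r v} := by
    calc ∑ B, P.real (E B) * P.real (J B)
        ≤ ∑ B : Set V, P.real (E B) *
            ∑ w, if w ∈ B then P.real {ω | w ∈ closedBall (U ω) r v} else 0 := by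
          refine Finset.sum_le_sum fun B _ => mul_le_mul_of_nonneg_left ?_ measureReal_nonneg
          rw [← Finset.sum_filter]
          refine le_trans (measureReal_mono ?_ (measure_ne_top _ _))
            (measureReal_biUnion_finset_le _ _)
          rintro ω ⟨w, hwB, hw⟩
          simp only [Set.mem_iUnion]
          exact ⟨w, by simpa using hwB, hw⟩
      _ = ∑ w, ∑ B : Set V, (if w ∈ B then P.real (E B) else 0) *
            P.real {ω | w ∈ closedBall (U ω) r v} := by
          rw [Finset.sum_comm]
          refine Finset.sum_congr rfl fun B _ => ?_
          rw [Finset.mul_sum]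
          exact Finset.sum_congr rfl fun w _ => by split_ifs <;> simp
      _ = _ := by
          refine Finset.sum_congr rfl fun w _ => ?_
          rw [← Finset.sum_mul, h.measureReal_eq_sum_closedBall r u {ω | w ∈ closedBall (U ω) r u}]
          congr 1
          refine Finset.sum_congr rfl fun B _ => ?_
          split_ifs with hw
          · congr 1
            ext ω
            simp only [hE, Set.mem_inter_iff, Set.mem_ofPred_eq]
            exact ⟨fun hω => ⟨hω, hω ▸ hw⟩, fun hω => hω.1⟩
          · rw [← measureReal_empty (μ := P)]
            congr 1
            ext ω
            simp only [Set.mem_inter_iff, Set.mem_ofPred_eq, Set.mem_empty_iff_false, false_iff]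
            rintro ⟨rfl, hw'⟩
            exact hw hw'
  -- If the balls of radius `r` meet, the centres are within distance `2r`.
  have hlast : ∑ B, P.real (E B ∩ J B) ≤ P.real {ω | v ∈ closedBall (U ω) (r + r) u} := by
    rw [h.measureReal_eq_sum_closedBall r u {ω | v ∈ closedBall (U ω) (r + r) u}]
    refine Finset.sum_le_sum fun B _ => measureReal_mono ?_
    rintro ω ⟨hω, w, hwB, hw⟩
    refine ⟨hω, mem_closedBall_add (w := w) ?_ hw⟩
    have hω' : closedBall (U ω) r u = B := hω
    rw [hω']
    exact hwB
  calc P.real (F u ∩ F v) = ∑ B, P.real (E B ∩ (F u ∩ F v)) :=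
        h.measureReal_eq_sum_closedBall r u _
    _ ≤ ∑ B, (P.real (E B ∩ F u) * P.real (F v) + P.real (E B) * P.real (J B) +
          P.real (E B ∩ J B)) := Finset.sum_le_sum fun B _ => hB B
    _ = P.real (F u) * P.real (F v) + ∑ B, P.real (E B) * P.real (J B) +
          ∑ B, P.real (E B ∩ J B) := by
        rw [Finset.sum_add_distrib, Finset.sum_add_distrib, ← Finset.sum_mul,
          ← h.measureReal_eq_sum_closedBall r u (F u)]
    _ ≤ _ := by gcongr

/-- The number of local events which occur has variance linear in the number of vertices. -/
lemma variance_sum_indicator_le (h : Resampling P U m) {r : ℕ} {F : V → Set Ω}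
    (hF : IsLocalFamily U m r F) (hFm : ∀ u, MeasurableSet (F u)) {δ : ℝ}
    (hδ : ∀ x y, P.real {ω | (U ω).Adj x y} ≤ δ) :
    Var[fun ω => ∑ u, (F u).indicator (fun _ => (1 : ℝ)) ω; P] ≤
      Fintype.card V * ((∑ j ∈ Finset.range (r + 1), (Fintype.card V * δ) ^ j) ^ 2 +
        ∑ j ∈ Finset.range (r + r + 1), (Fintype.card V * δ) ^ j) := by
  have hL2 : ∀ u ∈ (Finset.univ : Finset V),
      MemLp ((F u).indicator fun _ => (1 : ℝ)) 2 P := fun u _ =>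
    memLp_indicator_const 2 (hFm u) 1 (Or.inr (measure_ne_top _ _))
  have hcov : ∀ u v, cov[(F u).indicator fun _ => (1 : ℝ), (F v).indicator fun _ => (1 : ℝ); P] =
      P.real (F u ∩ F v) - P.real (F u) * P.real (F v) := by
    intro u v
    rw [covariance_eq_sub (hL2 u (Finset.mem_univ _)) (hL2 v (Finset.mem_univ _)),
      integral_indicator_const _ (hFm u), integral_indicator_const _ (hFm v)]
    have : ((F u).indicator fun _ => (1 : ℝ)) * ((F v).indicator fun _ => (1 : ℝ)) =
        (F u ∩ F v).indicator fun _ => (1 : ℝ) := by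
      ext ω
      simp only [Pi.mul_apply, Set.indicator, Set.mem_inter_iff]
      split_ifs <;> simp_all
    rw [this, integral_indicator_const _ ((hFm u).inter (hFm v))]
    simp
  have hvar := variance_fun_sum' (μ := P) (s := Finset.univ)
    (X := fun u => (F u).indicator fun _ => (1 : ℝ)) hL2
  rw [hvar]
  set b : V → V → ℝ := fun u w => P.real {ω | w ∈ closedBall (U ω) r u} with hb
  have hbsymm : ∀ u w, b u w = b w u := by
    intro u w
    simp only [hb]
    congr 1
    ext ω
    exact mem_closedBall_comm
  calc ∑ u, ∑ v, cov[(F u).indicator fun _ => (1 : ℝ), (F v).indicator fun _ => (1 : ℝ); P]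
      ≤ ∑ u, ∑ v, (∑ w, b u w * b v w + P.real {ω | v ∈ closedBall (U ω) (r + r) u}) := by
        refine Finset.sum_le_sum fun u _ => Finset.sum_le_sum fun v _ => ?_
        rw [hcov]
        linarith [h.prob_inter_le hF hFm u v]
    -- Balls are symmetric, so summing over `u` and `v` first leaves the squared expected size of
    -- the ball around the common point `w`.
    _ = ∑ w, (∑ u, b w u) ^ 2 + ∑ u, ∑ v, P.real {ω | v ∈ closedBall (U ω) (r + r) u} := by
        simp only [Finset.sum_add_distrib]
        congr 1
        have : ∀ w, (∑ u, b w u) ^ 2 = ∑ u, ∑ v, b u w * b v w := by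
          intro w
          rw [sq, Finset.sum_mul_sum]
          simp only [hbsymm w]
        simp only [this]
        symm
        rw [Finset.sum_comm]
        exact Finset.sum_congr rfl fun u _ => Finset.sum_comm
    _ ≤ ∑ w : V, (∑ j ∈ Finset.range (r + 1), (Fintype.card V * δ) ^ j) ^ 2 +
          ∑ u : V, ∑ j ∈ Finset.range (r + r + 1), (Fintype.card V * δ) ^ j := by
        refine add_le_add (Finset.sum_le_sum fun w _ => ?_) (Finset.sum_le_sum fun u _ => ?_)
        · exact pow_le_pow_left₀ (Finset.sum_nonneg fun u _ => measureReal_nonneg)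
            (h.sum_prob_mem_closedBall_le hδ r w) 2
        · exact h.sum_prob_mem_closedBall_le hδ (r + r) u
    _ = _ := by
        simp only [Finset.sum_const, Finset.card_univ, nsmul_eq_mul]
        ring

end Resampling

/-! ### Concentration of the intersection counts in the coupling -/

section Coupling

variable {n : ℕ}

/-- The union of the base graph and the first `k` fresh graphs. -/
def unionGraph (k : ℕ) (ω : Sample n) : SimpleGraph (Fin n) where
  Adj x y := ω.1.1.1.Adj x y ∨ ∃ t < k, (ω.2 t).1.Adj x y
  symm := ⟨fun x y h => by simpa only [SimpleGraph.adj_comm _ y x] using h⟩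
  loopless := ⟨fun x h => by simp at h⟩

lemma coupledGraph_le_unionGraph {k t : ℕ} (ht : t < k) (ω : Sample n) :
    coupledGraph ω t ≤ unionGraph k ω := by
  rintro x y (⟨-, h⟩ | ⟨-, h⟩)
  exacts [Or.inr ⟨t, ht, h⟩, Or.inl h]

lemma measurePreserving_base_graph (q p : I) :
    MeasurePreserving (fun ω : Sample n => ω.1.1.1) (couplingMeasure n q p)
      (SimpleGraph.binomialRandom (Fin n) q) :=
  measurePreserving_fst.comp (measurePreserving_fst.comp measurePreserving_fst)

lemma measurePreserving_fresh (q p : I) (t : ℕ) :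
    MeasurePreserving (fun ω : Sample n => ω.2 t) (couplingMeasure n q p) (labelledER n q) :=
  (measurePreserving_eval_infinitePi (fun _ : ℕ => labelledER n q) t).comp measurePreserving_snd

lemma measurePreserving_fresh_graph (q p : I) (t : ℕ) :
    MeasurePreserving (fun ω : Sample n => (ω.2 t).1) (couplingMeasure n q p)
      (SimpleGraph.binomialRandom (Fin n) q) :=
  measurePreserving_fst.comp (measurePreserving_fresh q p t)

lemma resampling_unionGraph (k : ℕ) (q p : I) :
    Resampling (couplingMeasure n q p) (unionGraph k) mergeSample where
  measurable_graph := by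
    refine SimpleGraph.measurable_iff_adj.2 fun x y => ?_
    have h : Measurable fun G : SimpleGraph (Fin n) => G.Adj x y :=
      SimpleGraph.measurable_iff_adj.1 measurable_id x y
    refine Measurable.or (h.comp (by fun_prop)) (Measurable.exists fun t => ?_)
    exact Measurable.and measurable_const (h.comp (by fun_prop))
  measurePreserving C := measurePreserving_mergeSample n q p C
  graph_eq C z := by
    ext x y
    simp only [unionGraph, mergeSample, resample, resampleGraph]
    by_cases h : x ∈ C ∧ y ∈ C <;> simp [h]

lemma prob_unionGraph_adj_le (k : ℕ) (q p : I) (x y : Fin n) :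
    (couplingMeasure n q p).real {ω | (unionGraph k ω).Adj x y} ≤ (k + 1) * q := by
  -- The variance bound wants one `δ` for all pairs, the diagonal included.
  by_cases hxy : x = y
  · subst hxy
    have hq : (0 : ℝ) ≤ q := q.2.1
    simp only [SimpleGraph.irrefl, Set.ofPred_false, measureReal_empty]
    positivity
  have hms : MeasurableSet {G : SimpleGraph (Fin n) | G.Adj x y} := MeasurableSet.of_discrete
  have hbase : (couplingMeasure n q p).real {ω | ω.1.1.1.Adj x y} = q := by
    rw [← binomialRandom_real_adj q hxy]
    exact congrArg ENNReal.toReal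
      ((measurePreserving_base_graph q p).measure_preimage hms.nullMeasurableSet)
  have hfresh : ∀ t, (couplingMeasure n q p).real {ω | (ω.2 t).1.Adj x y} = q := fun t => by
    rw [← binomialRandom_real_adj q hxy]
    exact congrArg ENNReal.toReal
      ((measurePreserving_fresh_graph q p t).measure_preimage hms.nullMeasurableSet)
  calc (couplingMeasure n q p).real {ω | (unionGraph k ω).Adj x y}
      ≤ (couplingMeasure n q p).real ({ω | ω.1.1.1.Adj x y} ∪
          ⋃ t ∈ Finset.range k, {ω | (ω.2 t).1.Adj x y}) := by
        refine measureReal_mono ?_ (measure_ne_top _ _)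
        rintro ω (h | ⟨t, ht, h⟩)
        · exact Or.inl h
        · refine Or.inr ?_
          simp only [Set.mem_iUnion]
          exact ⟨t, Finset.mem_range.2 ht, h⟩
    _ ≤ q + ∑ t ∈ Finset.range k, (q : ℝ) := by
        refine (measureReal_union_le _ _).trans (add_le_add hbase.le ?_)
        refine (measureReal_biUnion_finset_le _ _).trans (Finset.sum_le_sum fun t _ => ?_)
        exact (hfresh t).le
    _ = (k + 1) * q := by
        rw [Finset.sum_const, Finset.card_range, nsmul_eq_mul]
        ring

variable {r : ℕ} (f : Factor r)

/-- The event that `u` belongs to all the coupled sets with index in `T`. -/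
def Factor.interEvent (T : Finset ℕ) (u : Fin n) : Set (Sample n) :=
  {ω | ∀ t ∈ T, u ∈ f.coupledSet ω t}

lemma Factor.measurableSet_interEvent (T : Finset ℕ) (u : Fin n) :
    MeasurableSet (f.interEvent T u) := by
  have : f.interEvent T u = ⋂ t ∈ T, {ω | u ∈ f.coupledSet ω t} := by
    ext
    simp [Factor.interEvent]
  rw [this]
  exact Finset.measurableSet_biInter _ fun t _ => f.measurableSet_mem_coupledSet t u

/-- A ball in the union graph contains the balls of the same radius in all coupled graphs with index
below `k`, so one containment condition serves all indices at once. The percolation set is merged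
too, hence on either side of `C` the coupled graphs and labels agree with those of a single sample.
-/
lemma Factor.isLocalFamily_interEvent {k : ℕ} {T : Finset ℕ} (hT : ∀ t ∈ T, t < k) :
    IsLocalFamily (unionGraph (n := n) k) mergeSample r (f.interEvent T) where
  outside C u z h1 h2 := by
    refine forall₂_congr fun t ht => f.mem_select_congr (D := Cᶜ) ?_ ?_
      ((closedBall_mono (coupledGraph_le_unionGraph (hT t ht) _) r u).trans h2)
      ((closedBall_mono (coupledGraph_le_unionGraph (hT t ht) _) r u).trans h1)
    · intro a ha b hb
      rw [Set.mem_compl_iff] at ha hb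
      simp [coupledGraph, mergeSample, resample, resampleGraph, ha, hb]
    · intro a ha
      rw [Set.mem_compl_iff] at ha
      by_cases hS : a ∈ z.1.1.2 <;>
        simp [coupledLabel, mergeSample, resample, resampleLabel, ha, hS]
  inside C u z h1 h2 := by
    refine forall₂_congr fun t ht => f.mem_select_congr (D := C) ?_ ?_
      ((closedBall_mono (coupledGraph_le_unionGraph (hT t ht) _) r u).trans h2)
      ((closedBall_mono (coupledGraph_le_unionGraph (hT t ht) _) r u).trans h1)
    · intro a ha b hb
      simp [coupledGraph, mergeSample, resample, resampleGraph, ha, hb]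
    · intro a ha
      by_cases hS : a ∈ z.2.1.2 <;>
        simp [coupledLabel, mergeSample, resample, resampleLabel, ha, hS]

/-- The number of vertices in all the coupled sets with index in `T`. -/
noncomputable def Factor.interCount (T : Finset ℕ) (ω : Sample n) : ℝ :=
  ((⋂ t ∈ T, f.coupledSet ω t).ncard : ℝ)

lemma Factor.interCount_eq_sum (T : Finset ℕ) (ω : Sample n) :
    f.interCount T ω = ∑ u, (f.interEvent T u).indicator (fun _ => (1 : ℝ)) ω := by
  classical
  have : (⋂ t ∈ T, f.coupledSet ω t) =
      ((Finset.univ.filter fun u => ω ∈ f.interEvent T u : Finset (Fin n)) : Set (Fin n)) := by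
    ext u
    simp only [Set.mem_iInter, Finset.coe_filter, Finset.mem_univ, true_and]
    rfl
  rw [Factor.interCount, this, Set.ncard_coe_finset, Finset.card_filter]
  push_cast
  exact Finset.sum_congr rfl fun u _ => by simp [Set.indicator]

/-- Injectivity on all of `ℕ` is what allows reindexing the infinite product of fresh samples;
indices beyond `T.card` are sent above every element of `T`. -/
lemma exists_injective_image_range (T : Finset ℕ) :
    ∃ g : ℕ → ℕ, Function.Injective g ∧ (Finset.range T.card).image g = T := by
  classical
  refine ⟨fun j => if h : j < T.card then T.orderEmbOfFin rfl ⟨j, h⟩ else T.sup id + 1 + j,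
    ?_, ?_⟩
  · have hle : ∀ j (h : j < T.card), T.orderEmbOfFin rfl ⟨j, h⟩ ≤ T.sup id := fun j h =>
      Finset.le_sup (f := id) (T.orderEmbOfFin_mem rfl ⟨j, h⟩)
    intro a b hab
    dsimp only at hab
    split_ifs at hab with ha hb hb
    · have := (T.orderEmbOfFin rfl).injective hab
      simpa using this
    · have := hle a ha
      omega
    · have := hle b hb
      omega
    · omega
  · ext t
    simp only [Finset.mem_image, Finset.mem_range]
    constructor
    · rintro ⟨j, hj, rfl⟩
      rw [dif_pos hj]
      exact T.orderEmbOfFin_mem rfl ⟨j, hj⟩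
    · intro ht
      have : t ∈ Set.range (T.orderEmbOfFin rfl) := by
        rw [Finset.range_orderEmbOfFin]
        exact ht
      obtain ⟨⟨j, hj⟩, rfl⟩ := this
      exact ⟨j, hj, by rw [dif_pos hj]⟩

/-- The fresh samples are exchangeable given the base sample and the percolation set, so only the
number of indices matters. -/
lemma Factor.prob_interEvent_eq (q p : I) (T : Finset ℕ) (u : Fin n) :
    (couplingMeasure n q p).real (f.interEvent T u) =
      (couplingMeasure n q p).real (f.interEvent (Finset.range T.card) u) := by
  obtain ⟨g, hg, hgT⟩ := exists_injective_image_range T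
  have hmp : MeasurePreserving (fun ω : Sample n => ((ω.1, fun t => ω.2 (g t)) : Sample n))
      (couplingMeasure n q p) (couplingMeasure n q p) :=
    (MeasurePreserving.id _).prod
      (⟨by fun_prop, Measure.map_infinitePi_infinitePi_of_inj hg⟩ : MeasurePreserving
        (fun (s : ℕ → SimpleGraph (Fin n) × (Fin n → I)) t => s (g t)) _ _)
  have hpre : f.interEvent T u = (fun ω : Sample n => ((ω.1, fun t => ω.2 (g t)) : Sample n)) ⁻¹'
      f.interEvent (Finset.range T.card) u := by
    ext ω
    nth_rewrite 1 [← hgT]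
    simp only [Factor.interEvent, Set.mem_ofPred_eq, Finset.forall_mem_image, Set.mem_preimage]
    rfl
  conv_lhs => rw [hpre]
  exact congrArg ENNReal.toReal
    (hmp.measure_preimage (f.measurableSet_interEvent _ u).nullMeasurableSet)

lemma Factor.integral_interCount_eq_sum (q p : I) (T : Finset ℕ) :
    ∫ ω, f.interCount T ω ∂(couplingMeasure n q p) =
      ∑ u, (couplingMeasure n q p).real (f.interEvent T u) := by
  simp only [f.interCount_eq_sum]
  rw [integral_finsetSum]
  · refine Finset.sum_congr rfl fun u _ => ?_
    rw [integral_indicator_const _ (f.measurableSet_interEvent T u)]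
    simp
  · intro u _
    exact (integrable_const _).indicator (f.measurableSet_interEvent T u)

lemma Factor.integral_interCount (hn : n ≠ 0) (q p : I) (T : Finset ℕ) :
    ∫ ω, f.interCount T ω ∂(couplingMeasure n q p) = n * f.interDensity n q p T.card := by
  have h : f.interDensity n q p T.card =
      (∫ ω, f.interCount (Finset.range T.card) ω ∂(couplingMeasure n q p)) / n := by
    rw [Factor.interDensity, ← integral_div]
    rfl
  have hn' : (n : ℝ) ≠ 0 := by exact_mod_cast hn
  rw [h, mul_div_cancel₀ _ hn', f.integral_interCount_eq_sum, f.integral_interCount_eq_sum]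
  exact Finset.sum_congr rfl fun u _ => f.prob_interEvent_eq q p T u

lemma Factor.interCount_nonneg (T : Finset ℕ) (ω : Sample n) : 0 ≤ f.interCount T ω :=
  Nat.cast_nonneg _

lemma Factor.interCount_le (T : Finset ℕ) (ω : Sample n) : f.interCount T ω ≤ n := by
  unfold Factor.interCount
  have := Set.ncard_le_card (⋂ t ∈ T, f.coupledSet ω t)
  rw [Nat.card_eq_fintype_card, Fintype.card_fin] at this
  exact_mod_cast this

lemma Factor.memLp_interCount (q p : I) (T : Finset ℕ) :
    MemLp (f.interCount (n := n) T) 2 (couplingMeasure n q p) := by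
  have : f.interCount (n := n) T =
      fun ω => ∑ u, (f.interEvent T u).indicator (fun _ => (1 : ℝ)) ω := by
    funext ω
    exact f.interCount_eq_sum T ω
  rw [this]
  exact memLp_finsetSum _ fun u _ =>
    memLp_indicator_const 2 (f.measurableSet_interEvent T u) 1 (Or.inr (measure_ne_top _ _))

lemma Factor.interDensity_mem_Icc (hn : n ≠ 0) (q p : I) (i : ℕ) :
    f.interDensity n q p i ∈ Set.Icc (0 : ℝ) 1 := by
  have hn' : (0 : ℝ) < n := by exact_mod_cast Nat.pos_of_ne_zero hn
  have h := f.integral_interCount hn q p (Finset.range i)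
  rw [Finset.card_range] at h
  have h0 : 0 ≤ (n : ℝ) * f.interDensity n q p i := by
    rw [← h]
    exact integral_nonneg fun ω => f.interCount_nonneg _ ω
  have h1 : (n : ℝ) * f.interDensity n q p i ≤ n * 1 := by
    rw [← h, mul_one]
    calc ∫ ω, f.interCount (Finset.range i) ω ∂(couplingMeasure n q p)
        ≤ ∫ _, (n : ℝ) ∂(couplingMeasure n q p) :=
          integral_mono ((f.memLp_interCount q p _).integrable (by norm_num))
            (integrable_const _) fun ω => f.interCount_le _ ω
      _ = n := by simp
  exact ⟨nonneg_of_mul_nonneg_right h0 hn', le_of_mul_le_mul_left h1 hn'⟩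

/-- The constant in the variance bound for intersections of coupled sets. -/
noncomputable def varianceConst (lam : ℝ) (r k : ℕ) : ℝ :=
  (∑ j ∈ Finset.range (r + 1), ((k + 1) * lam) ^ j) ^ 2 +
    ∑ j ∈ Finset.range (r + r + 1), ((k + 1) * lam) ^ j

lemma edgeProb_le {lam : ℝ} (hlam : 0 ≤ lam) (n : ℕ) : (edgeProb lam n : ℝ) ≤ lam / n := by
  rw [edgeProb, Set.coe_projIcc]
  exact max_le (by positivity) (min_le_right _ _)

lemma edgeProb_eq {lam : ℝ} (hlam : 0 ≤ lam) {n : ℕ} (hn : lam ≤ n) (hn0 : n ≠ 0) :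
    (edgeProb lam n : ℝ) = lam / n := by
  have hn' : (0 : ℝ) < n := by exact_mod_cast Nat.pos_of_ne_zero hn0
  rw [edgeProb, Set.coe_projIcc, min_eq_right ((div_le_one hn').2 hn),
    max_eq_right (by positivity)]

/-- Chebyshev's inequality. The union graph has expected degree at most `(k + 1) * lam`, which makes
the variance constant independent of `n` and `p`. -/
lemma Factor.prob_interCount_deviation_le {lam : ℝ} (hlam : 0 ≤ lam) (hn : n ≠ 0) (p : I) {k : ℕ}
    {T : Finset ℕ} (hT : ∀ t ∈ T, t < k) {ε : ℝ} (hε : 0 < ε) :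
    (couplingMeasure n (edgeProb lam n) p).real
      {ω | ε * n ≤ |f.interCount T ω - n * f.interDensity n (edgeProb lam n) p T.card|} ≤
        varianceConst lam r k / (ε ^ 2 * n) := by
  have hn' : (0 : ℝ) < n := by exact_mod_cast Nat.pos_of_ne_zero hn
  set q := edgeProb lam n
  have hvar := (resampling_unionGraph (n := n) k q p).variance_sum_indicator_le
    (f.isLocalFamily_interEvent hT) (f.measurableSet_interEvent T) (prob_unionGraph_adj_le k q p)
  simp only [← f.interCount_eq_sum, Fintype.card_fin] at hvar
  have hq0 : (0 : ℝ) ≤ q := q.2.1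
  have hd0 : 0 ≤ n * ((k + 1) * (q : ℝ)) := by positivity
  have hd : n * ((k + 1) * (q : ℝ)) ≤ (k + 1) * lam := by
    calc n * ((k + 1) * (q : ℝ)) ≤ n * ((k + 1) * (lam / n)) := by
          gcongr
          exact edgeProb_le hlam n
      _ = (k + 1) * lam := by field_simp
  have hvar' : Var[f.interCount (n := n) T; couplingMeasure n q p] ≤
      n * varianceConst lam r k := by
    refine hvar.trans ?_
    unfold varianceConst
    gcongr
  have hcheb := meas_ge_le_variance_div_sq (f.memLp_interCount (n := n) q p T)
    (c := ε * n) (by positivity)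
  rw [f.integral_interCount hn] at hcheb
  have hreal := ENNReal.toReal_mono ENNReal.ofReal_ne_top hcheb
  rw [ENNReal.toReal_ofReal (div_nonneg (variance_nonneg _ _) (by positivity))] at hreal
  refine hreal.trans ?_
  calc Var[f.interCount (n := n) T; couplingMeasure n q p] / (ε * n) ^ 2
      ≤ n * varianceConst lam r k / (ε * n) ^ 2 := by gcongr
    _ = varianceConst lam r k / (ε ^ 2 * n) := by field_simp

/-- Each coupled pair `(G^t, Y^t)` is a randomly labelled Erdős–Rényi graph, so that properties
which hold almost surely for the latter hold for the former. -/
lemma ae_coupled {q : I} {Q : SimpleGraph (Fin n) × (Fin n → I) → Prop}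
    (hQ : ∀ᵐ z ∂(labelledER n q), Q z) (p : I) (t : ℕ) :
    ∀ᵐ ω ∂(couplingMeasure n q p), Q (coupledGraph ω t, coupledLabel ω t) := by
  have hpair : MeasurePreserving (fun ω : Sample n => (ω.1.1, ω.2 t)) (couplingMeasure n q p)
      ((labelledER n q).prod (labelledER n q)) :=
    (measurePreserving_fst (μ := labelledER n q) (ν := setBernoulli Set.univ p)).prod
      (measurePreserving_eval_infinitePi (fun _ : ℕ => labelledER n q) t)
  -- The percolation set is random, but there are only finitely many candidates: the property holds
  -- almost surely for all of them at once and can then be read at the actual one.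
  have hall : ∀ᵐ ω ∂(couplingMeasure n q p), ∀ S : Set (Fin n), Q (resample S (ω.1.1, ω.2 t)) :=
    ae_all_iff.2 fun S =>
      ((measurePreserving_resample n q S).comp hpair).quasiMeasurePreserving.ae hQ
  filter_upwards [hall] with ω hω using hω ω.1.2

end Coupling

/-! ### Alternating sums and inclusion-exclusion -/

section AlternatingSums

/-- The alternating sum of inclusion-exclusion for `k` sets, where `b i` is the size of the
intersection of any `i` of them. -/
noncomputable def altSum (k : ℕ) (b : ℕ → ℝ) : ℝ :=
  ∑ i ∈ Finset.Icc 1 k, (-1 : ℝ) ^ (i - 1) * (k.choose i : ℝ) * b i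

lemma altSum_eq_sum_powerset (k : ℕ) (b : ℕ → ℝ) :
    altSum k b = ∑ T ∈ (Finset.range k).powerset.erase ∅, (-1 : ℝ) ^ (T.card - 1) * b T.card := by
  have h := Finset.sum_powerset_apply_card (x := Finset.range k)
    (fun i => if i = 0 then 0 else (-1 : ℝ) ^ (i - 1) * b i)
  rw [Finset.card_range, Finset.sum_range_succ', ← Finset.add_sum_erase _ _
    (Finset.empty_mem_powerset _)] at h
  simp only [Finset.card_empty, if_true, zero_add, smul_zero, add_zero, Nat.succ_ne_zero,
    if_false] at h
  have hcongr : ∑ T ∈ (Finset.range k).powerset.erase ∅, (-1 : ℝ) ^ (T.card - 1) * b T.card =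
      ∑ T ∈ (Finset.range k).powerset.erase ∅,
        if T.card = 0 then 0 else (-1 : ℝ) ^ (T.card - 1) * b T.card := by
    refine Finset.sum_congr rfl fun T hT => ?_
    have : T.card ≠ 0 := by simpa using (Finset.mem_erase.1 hT).1
    rw [if_neg this]
  rw [altSum, hcongr, h, Finset.range_eq_Ico, Finset.sum_Ico_add' (fun i =>
    k.choose i • ((-1 : ℝ) ^ (i - 1) * b i)) 0 k 1]
  · have : Finset.Ico (0 + 1) (k + 1) = Finset.Icc 1 k := by
      ext i
      simp only [Finset.mem_Ico, Finset.mem_Icc]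
      omega
    rw [this]
    refine Finset.sum_congr rfl fun i _ => ?_
    rw [nsmul_eq_mul]
    ring

lemma abs_sum_powerset_sub_altSum_le (k : ℕ) (N : Finset ℕ → ℝ) (b : ℕ → ℝ) {η : ℝ} (hη : 0 ≤ η)
    (h : ∀ T ∈ (Finset.range k).powerset.erase ∅, |N T - b T.card| ≤ η) :
    |∑ T ∈ (Finset.range k).powerset.erase ∅, (-1 : ℝ) ^ (T.card - 1) * N T - altSum k b| ≤
      2 ^ k * η := by
  rw [altSum_eq_sum_powerset, ← Finset.sum_sub_distrib]
  calc |∑ T ∈ (Finset.range k).powerset.erase ∅,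
        ((-1 : ℝ) ^ (T.card - 1) * N T - (-1 : ℝ) ^ (T.card - 1) * b T.card)|
      ≤ ∑ T ∈ (Finset.range k).powerset.erase ∅,
        |(-1 : ℝ) ^ (T.card - 1) * N T - (-1 : ℝ) ^ (T.card - 1) * b T.card| :=
        Finset.abs_sum_le_sum_abs _ _
    _ ≤ ∑ T ∈ (Finset.range k).powerset.erase ∅, η := by
        refine Finset.sum_le_sum fun T hT => ?_
        rw [← mul_sub, abs_mul, abs_pow, abs_neg, abs_one, one_pow, one_mul]
        exact h T hT
    _ ≤ ∑ T ∈ (Finset.range k).powerset, η :=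
        Finset.sum_le_sum_of_subset_of_nonneg (Finset.erase_subset _ _) fun _ _ _ => hη
    _ = 2 ^ k * η := by
        rw [Finset.sum_const, Finset.card_powerset, Finset.card_range, nsmul_eq_mul]
        push_cast
        rfl

/-- Inclusion-exclusion at a single point: the signed sum over all subsets of a nonempty set
vanishes, so its nonempty part balances the term of `∅`. -/
lemma sum_nonempty_subsets (k : ℕ) {s : Finset ℕ} (hs : s ⊆ Finset.range k) :
    ∑ T ∈ (Finset.range k).powerset.erase ∅, (-1 : ℝ) ^ (T.card - 1) * (if T ⊆ s then 1 else 0) =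
      if s.Nonempty then 1 else 0 := by
  have h : (∑ T ∈ s.powerset, (-1 : ℤ) ^ T.card) = if s = ∅ then 1 else 0 :=
    Finset.sum_powerset_neg_one_pow_card
  have h' : (∑ T ∈ s.powerset, (-1 : ℝ) ^ T.card) = if s = ∅ then 1 else 0 := by
    have := congrArg (Int.cast : ℤ → ℝ) h
    push_cast at this
    exact this
  rw [← Finset.add_sum_erase _ _ (Finset.empty_mem_powerset _)] at h'
  have hsub : s.powerset.erase ∅ ⊆ (Finset.range k).powerset.erase ∅ :=
    Finset.erase_subset_erase _ (Finset.powerset_mono.2 hs)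
  rw [← Finset.sum_subset hsub]
  · have hneg : ∑ T ∈ s.powerset.erase ∅, (-1 : ℝ) ^ (T.card - 1) * (if T ⊆ s then 1 else 0) =
        - ∑ T ∈ s.powerset.erase ∅, (-1 : ℝ) ^ T.card := by
      rw [← Finset.sum_neg_distrib]
      refine Finset.sum_congr rfl fun T hT => ?_
      rw [Finset.mem_erase, Finset.mem_powerset] at hT
      rw [if_pos hT.2, mul_one]
      obtain ⟨c, hc⟩ := Nat.exists_eq_succ_of_ne_zero (Finset.card_ne_zero.2
        (Finset.nonempty_iff_ne_empty.2 hT.1))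
      rw [hc, Nat.succ_eq_add_one, Nat.add_sub_cancel, pow_succ]
      ring
    rw [hneg]
    simp only [Finset.card_empty, pow_zero] at h'
    rcases s.eq_empty_or_nonempty with rfl | hne
    · simp
    · rw [if_neg hne.ne_empty] at h'
      rw [if_pos hne]
      linarith
  · intro T hT hT'
    have : ¬ T ⊆ s := fun h => hT' (Finset.mem_erase.2
      ⟨(Finset.mem_erase.1 hT).1, Finset.mem_powerset.2 h⟩)
    rw [if_neg this, mul_zero]

end AlternatingSums

/-! ### Counting patterns and intersecting pairs -/

section Profiles

variable {V : Type} [Fintype V]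

/-- The number of vertices whose pattern contains `T`. -/
noncomputable def patternCount (τ : V → Finset ℕ) (T : Finset ℕ) : ℝ :=
  ((Finset.univ.filter fun v => T ⊆ τ v).card : ℝ)

lemma card_nonempty_pattern {k : ℕ} {τ : V → Finset ℕ} (hτ : ∀ v, τ v ⊆ Finset.range k) :
    ((Finset.univ.filter fun v => (τ v).Nonempty).card : ℝ) =
      ∑ T ∈ (Finset.range k).powerset.erase ∅, (-1 : ℝ) ^ (T.card - 1) * patternCount τ T := by
  simp only [patternCount, Finset.card_filter, Nat.cast_sum, Finset.mul_sum]
  rw [Finset.sum_comm]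
  refine Finset.sum_congr rfl fun v _ => ?_
  have := sum_nonempty_subsets k (hτ v)
  push_cast
  exact this.symm

/-- The square of a count is a count of ordered pairs with `T` inside both patterns, that is, inside
their intersection; inclusion-exclusion is then applied to that intersection. -/
lemma card_intersecting_pairs {k : ℕ} {τ : V → Finset ℕ} (hτ : ∀ v, τ v ⊆ Finset.range k) :
    ((Finset.univ.filter fun z : V × V => (τ z.1 ∩ τ z.2).Nonempty).card : ℝ) =
      ∑ T ∈ (Finset.range k).powerset.erase ∅, (-1 : ℝ) ^ (T.card - 1) * patternCount τ T ^ 2 := by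
  have hsq : ∀ T, patternCount τ T ^ 2 =
      ∑ z : V × V, if T ⊆ τ z.1 ∩ τ z.2 then (1 : ℝ) else 0 := by
    intro T
    rw [patternCount, sq, Finset.card_filter, ← Finset.univ_product_univ, Finset.sum_product]
    push_cast
    rw [Finset.sum_mul_sum]
    refine Finset.sum_congr rfl fun u _ => Finset.sum_congr rfl fun v _ => ?_
    by_cases h1 : T ⊆ τ u <;> by_cases h2 : T ⊆ τ v <;> simp [Finset.subset_inter_iff, h1, h2]
  simp only [hsq, Finset.card_filter, Nat.cast_sum, Finset.mul_sum]
  rw [Finset.sum_comm]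
  refine Finset.sum_congr rfl fun z _ => ?_
  have := sum_nonempty_subsets k (Finset.inter_subset_left.trans (hτ z.1) :
    τ z.1 ∩ τ z.2 ⊆ Finset.range k)
  push_cast
  exact this.symm

open Classical in
/-- The pairs of distinct vertices whose patterns intersect. -/
noncomputable def patternEdges (τ : V → Finset ℕ) : Finset (Sym2 V) :=
  Finset.univ.filter fun e => ¬ e.IsDiag ∧ ∃ t, ∀ v ∈ e, t ∈ τ v

lemma mem_patternEdges {τ : V → Finset ℕ} {e : Sym2 V} :
    e ∈ patternEdges τ ↔ ¬ e.IsDiag ∧ ∃ t, ∀ v ∈ e, t ∈ τ v := by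
  simp [patternEdges]

/-- The first term pays for the diagonal; each remaining unordered pair occurs in two orders. -/
lemma card_intersecting_pairs_le (τ : V → Finset ℕ) :
    ((Finset.univ.filter fun z : V × V => (τ z.1 ∩ τ z.2).Nonempty).card : ℝ) ≤
      Fintype.card V + 2 * (patternEdges τ).card := by
  classical
  set Q := Finset.univ.filter fun z : V × V => (τ z.1 ∩ τ z.2).Nonempty
  have h1 : (Q.filter fun z => z.1 = z.2).card ≤ Fintype.card V := by
    refine Finset.card_le_card_of_injOn (t := Finset.univ) Prod.fst (by simp) ?_
    rintro ⟨a, b⟩ hab ⟨c, d⟩ hcd h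
    simp only [Finset.coe_filter, Set.mem_ofPred_eq] at hab hcd h
    rw [← hab.2, ← hcd.2, h]
  have h2 : (Q.filter fun z => ¬ z.1 = z.2).card ≤ 2 * (patternEdges τ).card := by
    refine Finset.card_le_mul_card_image_of_maps_to (f := fun z : V × V => s(z.1, z.2)) ?_ 2 ?_
    · rintro ⟨a, b⟩ hab
      simp only [Q, Finset.mem_filter, Finset.mem_univ, true_and] at hab
      obtain ⟨⟨t, ht⟩, hne⟩ := hab
      rw [Finset.mem_inter] at ht
      rw [mem_patternEdges, Sym2.mk_isDiag_iff]
      refine ⟨hne, t, fun v hv => ?_⟩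
      rcases Sym2.mem_iff.1 hv with rfl | rfl
      exacts [ht.1, ht.2]
    · intro e _
      induction e using Sym2.inductionOn with
      | _ a b =>
        refine (Finset.card_le_card (t := {(a, b), (b, a)}) ?_).trans Finset.card_le_two
        rintro ⟨c, d⟩ hcd
        have := (Finset.mem_filter.1 hcd).2
        rcases Sym2.eq_iff.1 this with ⟨h, h'⟩ | ⟨h, h'⟩ <;> simp_all
  have h3 := Finset.card_filter_add_card_filter_not (s := Q) fun z => z.1 = z.2
  have : Q.card ≤ Fintype.card V + 2 * (patternEdges τ).card := by omega
  exact_mod_cast this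

/-- Few patterns have a small support: the sum of `λ ^ (- |support|)` over all patterns is at most
`(1 - 2 ^ k / λ) ^ (-n)`. -/
lemma sum_prod_pattern_weight_le [DecidableEq V] (k : ℕ) {x : ℝ} (hx : 0 ≤ x)
    (hx1 : 2 ^ k * x ≤ 1) :
    ∑ τ ∈ Fintype.piFinset (fun _ : V => (Finset.range k).powerset),
      x ^ (Finset.univ.filter fun v => (τ v).Nonempty).card * (1 - 2 ^ k * x) ^ Fintype.card V ≤
        1 := by
  have h0 : 0 ≤ 1 - 2 ^ k * x := by linarith
  have hk : (0 : ℝ) < 2 ^ k := by positivity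
  calc ∑ τ ∈ Fintype.piFinset (fun _ : V => (Finset.range k).powerset),
        x ^ (Finset.univ.filter fun v => (τ v).Nonempty).card * (1 - 2 ^ k * x) ^ Fintype.card V
      -- Weight `x` on nonempty patterns and `1 - 2 ^ k * x` on the empty one has total at most 1 at
      -- each vertex. Raising the second factor to the power of all vertices, not just those with
      -- empty pattern, only decreases the term.
      ≤ ∑ τ ∈ Fintype.piFinset (fun _ : V => (Finset.range k).powerset),
          ∏ v, if (τ v).Nonempty then x else 1 - 2 ^ k * x := by
        refine Finset.sum_le_sum fun τ _ => ?_
        rw [Finset.prod_ite, Finset.prod_const, Finset.prod_const]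
        refine mul_le_mul_of_nonneg_left ?_ (pow_nonneg hx _)
        refine pow_le_pow_of_le_one h0 ?_ (Finset.card_le_univ _)
        linarith [mul_nonneg hk.le hx]
    _ = ∏ _ : V, ∑ T ∈ (Finset.range k).powerset, if T.Nonempty then x else 1 - 2 ^ k * x :=
        by rw [Finset.prod_univ_sum]
    _ ≤ 1 := by
        refine Finset.prod_le_one (fun v _ => Finset.sum_nonneg fun T _ => ?_) fun v _ => ?_
        · split_ifs
          exacts [hx, h0]
        · rw [← Finset.add_sum_erase _ _ (Finset.empty_mem_powerset _), if_neg (by simp)]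
          calc 1 - 2 ^ k * x + ∑ T ∈ (Finset.range k).powerset.erase ∅,
                (if T.Nonempty then x else 1 - 2 ^ k * x)
              = 1 - 2 ^ k * x + ∑ T ∈ (Finset.range k).powerset.erase ∅, x := by
                congr 1
                refine Finset.sum_congr rfl fun T hT => if_pos ?_
                exact Finset.nonempty_iff_ne_empty.2 (Finset.mem_erase.1 hT).1
            _ ≤ 1 - 2 ^ k * x + ∑ T ∈ (Finset.range k).powerset, x := by
                gcongr
                exact Finset.erase_subset _ _
            _ = 1 := by
                rw [Finset.sum_const, Finset.card_powerset, Finset.card_range, nsmul_eq_mul]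
                push_cast
                ring

end Profiles

/-! ### Probability that prescribed sets are independent -/

section Independence

variable {n : ℕ}

/-- For fixed sets, the probability that they are all independent in the respective coupled graphs
is at most the probability that a single random graph avoids all the pairs in the sets. -/
lemma prob_isIndepSet_le (q p : I) (k : ℕ) (τ : Fin n → Finset ℕ)
    (hτ : ∀ v, τ v ⊆ Finset.range k) :
    (couplingMeasure n q p).real
      {ω | ∀ t < k, (coupledGraph ω t).IsIndepSet {v | t ∈ τ v}} ≤
        (1 - (q : ℝ)) ^ (patternEdges τ).card := by
  classical
  set K := patternEdges τ with hK
  have hKdiag : ∀ e ∈ K, ¬ e.IsDiag := fun e he => (mem_patternEdges.1 he).1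
  -- For a given `S`, a pair not inside `S` is tested in the base graph, which all coupled graphs
  -- share there; a pair inside `S` is tested in the fresh graph of each common index. These are
  -- distinct independent coins, and every pair gets at least one.
  let K₁ : Set (Fin n) → Finset (Sym2 (Fin n)) := fun S => K.filter fun e => ¬ ∀ v ∈ e, v ∈ S
  let K₂ : Set (Fin n) → ℕ → Finset (Sym2 (Fin n)) := fun S t =>
    K.filter fun e => (∀ v ∈ e, v ∈ S) ∧ ∀ v ∈ e, t ∈ τ v
  let A : Finset (Sym2 (Fin n)) → Set (SimpleGraph (Fin n)) := fun D =>
    {G | ∀ e ∈ D, e ∉ G.edgeSet}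
  have hq1 : 0 ≤ 1 - (q : ℝ) := sub_nonneg.2 q.2.2
  have hq1' : 1 - (q : ℝ) ≤ 1 := sub_le_self _ q.2.1
  have hcard : ∀ S, K.card ≤ (K₁ S).card + ∑ t ∈ Finset.range k, (K₂ S t).card := by
    intro S
    have hsub : K ⊆ K₁ S ∪ (Finset.range k).biUnion (K₂ S) := by
      intro e he
      by_cases hS : ∀ v ∈ e, v ∈ S
      · obtain ⟨t, ht⟩ := (mem_patternEdges.1 he).2
        have htk : t ∈ Finset.range k := hτ _ (ht _ (Sym2.out_fst_mem e))
        exact Finset.mem_union_right _ (Finset.mem_biUnion.2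
          ⟨t, htk, Finset.mem_filter.2 ⟨he, hS, ht⟩⟩)
      · exact Finset.mem_union_left _ (Finset.mem_filter.2 ⟨he, hS⟩)
    exact (Finset.card_le_card hsub).trans ((Finset.card_union_le _ _).trans
      (Nat.add_le_add_left Finset.card_biUnion_le _))
  have hA : ∀ D ⊆ K, (labelledER n q).real (A D ×ˢ Set.univ) = (1 - (q : ℝ)) ^ D.card := by
    intro D hD
    rw [labelledER, measureReal_prod_prod, probReal_univ, mul_one]
    exact binomialRandom_real_forall_notMem q D fun e he => hKdiag e (hD he)
  -- Fixing the percolation set to be `S` makes the condition a product event.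
  let R : Set (Fin n) → Set (Sample n) := fun S =>
    ((A (K₁ S) ×ˢ Set.univ) ×ˢ {S}) ×ˢ
      Set.pi (Finset.range k : Set ℕ) fun t => A (K₂ S t) ×ˢ Set.univ
  have hR : ∀ S, (couplingMeasure n q p).real (R S) ≤
      (setBernoulli Set.univ p).real {S} * (1 - (q : ℝ)) ^ K.card := by
    intro S
    have hpi : (Measure.infinitePi fun _ : ℕ => labelledER n q).real
        (Set.pi (Finset.range k : Set ℕ) fun t => A (K₂ S t) ×ˢ Set.univ) =
          ∏ t ∈ Finset.range k, (1 - (q : ℝ)) ^ (K₂ S t).card := by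
      rw [measureReal_def, Measure.infinitePi_pi]
      · rw [ENNReal.toReal_prod]
        exact Finset.prod_congr rfl fun t _ => hA _ (Finset.filter_subset _ _)
      · exact fun t _ => MeasurableSet.prod MeasurableSet.of_discrete MeasurableSet.univ
    rw [couplingMeasure, measureReal_prod_prod, measureReal_prod_prod, hpi,
      hA _ (Finset.filter_subset _ _), Finset.prod_pow_eq_pow_sum, mul_comm (_ ^ _), mul_assoc,
      ← pow_add]
    exact mul_le_mul_of_nonneg_left (pow_le_pow_of_le_one hq1 hq1' (hcard S)) measureReal_nonneg
  have hsub : {ω : Sample n | ∀ t < k, (coupledGraph ω t).IsIndepSet {v | t ∈ τ v}} ⊆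
      ⋃ S ∈ (Finset.univ : Finset (Set (Fin n))), R S := by
    intro ω hω
    have hno : ∀ t < k, ∀ a b, a ≠ b → t ∈ τ a → t ∈ τ b → ¬ (coupledGraph ω t).Adj a b :=
      fun t ht a b hab ha hb => hω t ht (x := a) ha (y := b) hb hab
    simp only [Finset.mem_univ, Set.iUnion_true, Set.mem_iUnion]
    refine ⟨ω.1.2, ⟨⟨⟨?_, trivial⟩, rfl⟩, ?_⟩⟩
    · intro e he
      induction e using Sym2.inductionOn with
      | _ a b =>
        obtain ⟨heK, heS⟩ := Finset.mem_filter.1 he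
        obtain ⟨hd, t, ht⟩ := mem_patternEdges.1 heK
        have ha := ht a (Sym2.mem_mk_left a b)
        have hb := ht b (Sym2.mem_mk_right a b)
        rw [SimpleGraph.mem_edgeSet]
        intro hadj
        refine hno t (Finset.mem_range.1 (hτ a ha)) a b (by simpa using hd) ha hb
          (Or.inr ⟨?_, hadj⟩)
        rintro ⟨h1, h2⟩
        refine heS fun v hv => ?_
        rcases Sym2.mem_iff.1 hv with rfl | rfl
        exacts [h1, h2]
    · intro t ht
      refine ⟨?_, trivial⟩
      intro e he
      induction e using Sym2.inductionOn with
      | _ a b =>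
        obtain ⟨heK, heS, het⟩ := Finset.mem_filter.1 he
        have hd := (mem_patternEdges.1 heK).1
        rw [SimpleGraph.mem_edgeSet]
        intro hadj
        exact hno t (Finset.mem_range.1 ht) a b (by simpa using hd)
          (het a (Sym2.mem_mk_left a b)) (het b (Sym2.mem_mk_right a b))
          (Or.inl ⟨⟨heS a (Sym2.mem_mk_left a b), heS b (Sym2.mem_mk_right a b)⟩, hadj⟩)
  calc (couplingMeasure n q p).real
        {ω | ∀ t < k, (coupledGraph ω t).IsIndepSet {v | t ∈ τ v}}
      ≤ (couplingMeasure n q p).real (⋃ S ∈ (Finset.univ : Finset (Set (Fin n))), R S) :=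
        measureReal_mono hsub (measure_ne_top _ _)
    _ ≤ ∑ S : Set (Fin n), (couplingMeasure n q p).real (R S) := measureReal_biUnion_finset_le _ _
    _ ≤ ∑ S : Set (Fin n), (setBernoulli Set.univ p).real {S} * (1 - (q : ℝ)) ^ K.card :=
        Finset.sum_le_sum fun S _ => hR S
    _ = (1 - (q : ℝ)) ^ K.card := by
        rw [← Finset.sum_mul, sum_measureReal_singleton, Finset.coe_univ, probReal_univ, one_mul]

end Independence

/-! ### The union bound over patterns -/

section FirstMoment

variable {n r : ℕ} (f : Factor r)

/-- The indices below `k` of the coupled sets containing a vertex. -/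
noncomputable def Factor.pattern (k : ℕ) (ω : Sample n) (v : Fin n) : Finset ℕ :=
  open Classical in (Finset.range k).filter fun t => v ∈ f.coupledSet ω t

lemma Factor.mem_pattern {k : ℕ} {ω : Sample n} {v : Fin n} {t : ℕ} :
    t ∈ f.pattern k ω v ↔ t < k ∧ v ∈ f.coupledSet ω t := by
  simp [Factor.pattern]

lemma Factor.patternCount_pattern {k : ℕ} (ω : Sample n) {T : Finset ℕ} (hT : T ⊆ Finset.range k) :
    patternCount (f.pattern k ω) T = f.interCount T ω := by
  have : (⋂ t ∈ T, f.coupledSet ω t) =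
      ((Finset.univ.filter fun v => T ⊆ f.pattern k ω v : Finset (Fin n)) : Set (Fin n)) := by
    ext v
    simp only [Set.mem_iInter, Finset.coe_filter, Finset.mem_univ, true_and, Set.mem_ofPred_eq]
    refine forall₂_congr fun t ht => ?_
    rw [f.mem_pattern]
    exact ⟨fun h => ⟨Finset.mem_range.1 (hT ht), h⟩, fun h => h.2⟩
  rw [patternCount, Factor.interCount, this, Set.ncard_coe_finset]

/-- The union bound over all patterns with prescribed intersection densities. -/
lemma Factor.half_le_sum_patterns {q p : I} {k : ℕ}
    (hind : ∀ᵐ z ∂(labelledER n q), z.1.IsIndepSet (f.select z.1 z.2)) {c : ℕ → ℝ} {η θ : ℝ}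
    (hθ : 2 ^ k * θ ≤ 1 / 2)
    (hdev : ∀ T ⊆ Finset.range k,
      (couplingMeasure n q p).real {ω | η ≤ |f.interCount T ω - c T.card|} ≤ θ) :
    1 / 2 ≤ ∑ τ ∈ (Fintype.piFinset fun _ : Fin n => (Finset.range k).powerset) with
      (∀ T ∈ (Finset.range k).powerset.erase ∅, |patternCount τ T - c T.card| ≤ η),
        (1 - (q : ℝ)) ^ (patternEdges τ).card := by
  classical
  set P := couplingMeasure n q p
  set 𝒯 := (Fintype.piFinset fun _ : Fin n => (Finset.range k).powerset).filter
    fun τ => ∀ T ∈ (Finset.range k).powerset.erase ∅, |patternCount τ T - c T.card| ≤ η with h𝒯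
  let E : (Fin n → Finset ℕ) → Set (Sample n) := fun τ =>
    {ω | ∀ t < k, (coupledGraph ω t).IsIndepSet {v | t ∈ τ v}}
  let D : Finset ℕ → Set (Sample n) := fun T => {ω | η ≤ |f.interCount T ω - c T.card|}
  -- Almost surely the true pattern is a witness for the first union, unless some intersection count
  -- deviates.
  have hae : ∀ᵐ ω ∂P, ω ∈ (⋃ τ ∈ 𝒯, E τ) ∪ ⋃ T ∈ (Finset.range k).powerset, D T := by
    have h := ae_all_iff.2 fun t => ae_coupled hind p t
    filter_upwards [h] with ω hω
    by_cases hD : ω ∈ ⋃ T ∈ (Finset.range k).powerset, D T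
    · exact Or.inr hD
    left
    simp only [Set.mem_iUnion, not_exists] at hD
    simp only [Set.mem_iUnion]
    refine ⟨f.pattern k ω, ?_, ?_⟩
    · rw [h𝒯, Finset.mem_filter, Fintype.mem_piFinset]
      refine ⟨fun v => Finset.mem_powerset.2 fun t ht =>
        Finset.mem_range.2 (f.mem_pattern.1 ht).1, fun T hT => ?_⟩
      have hT' := Finset.mem_of_mem_erase hT
      rw [f.patternCount_pattern ω (Finset.mem_powerset.1 hT')]
      exact (not_le.1 (hD T hT')).le
    · intro t ht
      have : {v | t ∈ f.pattern k ω v} = f.coupledSet ω t := by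
        ext v
        simp [f.mem_pattern, ht]
      rw [this]
      exact hω t
  have h1 : 1 ≤ P.real ((⋃ τ ∈ 𝒯, E τ) ∪ ⋃ T ∈ (Finset.range k).powerset, D T) := by
    have : P ((⋃ τ ∈ 𝒯, E τ) ∪ ⋃ T ∈ (Finset.range k).powerset, D T) = 1 :=
      (measure_congr (eventuallyEq_univ.2 hae)).trans measure_univ
    rw [measureReal_def, this, ENNReal.toReal_one]
  have h2 : P.real (⋃ T ∈ (Finset.range k).powerset, D T) ≤ 2 ^ k * θ := by
    refine (measureReal_biUnion_finset_le _ _).trans ?_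
    refine (Finset.sum_le_sum fun T hT => hdev T (Finset.mem_powerset.1 hT)).trans_eq ?_
    rw [Finset.sum_const, Finset.card_powerset, Finset.card_range, nsmul_eq_mul]
    push_cast
    rfl
  have h3 : P.real (⋃ τ ∈ 𝒯, E τ) ≤ ∑ τ ∈ 𝒯, (1 - (q : ℝ)) ^ (patternEdges τ).card := by
    refine (measureReal_biUnion_finset_le _ _).trans (Finset.sum_le_sum fun τ hτ => ?_)
    refine prob_isIndepSet_le q p k τ fun v => ?_
    exact Finset.mem_powerset.1 (Fintype.mem_piFinset.1 (Finset.mem_filter.1 hτ).1 v)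
  have h4 := measureReal_union_le (μ := P) (⋃ τ ∈ 𝒯, E τ) (⋃ T ∈ (Finset.range k).powerset, D T)
  linarith

/-- Comparison of the number of patterns with the probability that all of their pairs are
avoided. -/
lemma neg_log_two_le_of_half_le_sum {q : I} {k : ℕ} {a : ℕ → ℝ} (ha : ∀ i, a i ∈ Set.Icc (0 : ℝ) 1)
    {ε lam : ℝ} (hε : 0 ≤ ε) (hlam : 1 ≤ lam) (hk : 2 ^ k / lam ≤ 1 / 2) (hn : n ≠ 0)
    (h : 1 / 2 ≤ ∑ τ ∈ (Fintype.piFinset fun _ : Fin n => (Finset.range k).powerset) with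
      (∀ T ∈ (Finset.range k).powerset.erase ∅, |patternCount τ T - n * a T.card| ≤ ε * n),
        (1 - (q : ℝ)) ^ (patternEdges τ).card) :
    - Real.log 2 ≤ n * (altSum k a + 2 ^ k * ε) * Real.log lam + 2 * (2 ^ k / lam) * n -
      q / 2 * (n ^ 2 * (altSum k (fun i => a i ^ 2) - 2 ^ k * (2 * ε)) - n) := by
  set B := n * (altSum k a + 2 ^ k * ε) * Real.log lam + 2 * (2 ^ k / lam) * n -
      q / 2 * (n ^ 2 * (altSum k (fun i => a i ^ 2) - 2 ^ k * (2 * ε)) - n) with hB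
  have hlam0 : 0 < lam := by linarith
  have hn' : (0 : ℝ) < n := by exact_mod_cast Nat.pos_of_ne_zero hn
  have hlog : 0 ≤ Real.log lam := Real.log_nonneg hlam
  have hq0 : (0 : ℝ) ≤ q := q.2.1
  set x := lam⁻¹ with hx
  have hx0 : 0 < x := inv_pos.2 hlam0
  have hkx : 2 ^ k / lam = 2 ^ k * x := div_eq_mul_inv _ _
  rw [hkx] at hk
  -- Each probability is compared with the pattern weight at `x = 1 / lam`. The factor `exp B` is
  -- uniform in the pattern because the counts control the support size `M` from above and the
  -- number of edges `e` from below; the weights then sum to at most 1.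
  have hterm : ∀ τ ∈ (Fintype.piFinset fun _ : Fin n => (Finset.range k).powerset).filter
      (fun τ => ∀ T ∈ (Finset.range k).powerset.erase ∅,
        |patternCount τ T - n * a T.card| ≤ ε * n),
      (1 - (q : ℝ)) ^ (patternEdges τ).card ≤ Real.exp B *
        (x ^ (Finset.univ.filter fun v => (τ v).Nonempty).card *
          (1 - 2 ^ k * x) ^ Fintype.card (Fin n)) := by
    intro τ hτ
    obtain ⟨hτ1, hτ2⟩ := Finset.mem_filter.1 hτ
    have hτ1' : ∀ v, τ v ⊆ Finset.range k := fun v =>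
      Finset.mem_powerset.1 (Fintype.mem_piFinset.1 hτ1 v)
    set M := (Finset.univ.filter fun v => (τ v).Nonempty).card
    set e := (patternEdges τ).card
    have hM : (M : ℝ) ≤ n * (altSum k a + 2 ^ k * ε) := by
      have h1 := abs_sum_powerset_sub_altSum_le k (patternCount τ) (fun i => n * a i)
        (by positivity) hτ2
      rw [← card_nonempty_pattern hτ1'] at h1
      have h2 : altSum k (fun i => n * a i) = n * altSum k a := by
        simp only [altSum, Finset.mul_sum]
        exact Finset.sum_congr rfl fun i _ => by ring
      rw [h2] at h1
      have := (abs_le.1 h1).2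
      linarith
    have hpc : ∀ T, patternCount τ T ∈ Set.Icc (0 : ℝ) n := by
      intro T
      refine ⟨Nat.cast_nonneg _, ?_⟩
      have := Finset.card_le_univ (Finset.univ.filter fun v => T ⊆ τ v)
      rw [Fintype.card_fin] at this
      exact Nat.cast_le.2 this
    have he : n ^ 2 * (altSum k (fun i => a i ^ 2) - 2 ^ k * (2 * ε)) - n ≤ 2 * (e : ℝ) := by
      have h1 := abs_sum_powerset_sub_altSum_le k (fun T => patternCount τ T ^ 2)
        (fun i => n ^ 2 * a i ^ 2) (η := 2 * ε * n ^ 2) (by positivity) (by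
          intro T hT
          have hd := hτ2 T hT
          obtain ⟨h0, h1⟩ := hpc T
          obtain ⟨h2, h3⟩ := ha T.card
          have hfac : patternCount τ T ^ 2 - n ^ 2 * a T.card ^ 2 =
              (patternCount τ T + n * a T.card) * (patternCount τ T - n * a T.card) := by ring
          have hna : n * a T.card ≤ n := mul_le_of_le_one_right hn'.le h3
          have hna0 : 0 ≤ n * a T.card := by positivity
          rw [hfac, abs_mul, abs_of_nonneg (by linarith)]
          calc (patternCount τ T + n * a T.card) * |patternCount τ T - n * a T.card|
              ≤ (n + n) * (ε * n) := by gcongr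
            _ = 2 * ε * n ^ 2 := by ring)
      rw [← card_intersecting_pairs hτ1'] at h1
      have h2 : altSum k (fun i => (n : ℝ) ^ 2 * a i ^ 2) =
          n ^ 2 * altSum k (fun i => a i ^ 2) := by
        simp only [altSum, Finset.mul_sum]
        exact Finset.sum_congr rfl fun i _ => by ring
      rw [h2] at h1
      have h3 := card_intersecting_pairs_le τ
      rw [Fintype.card_fin] at h3
      have := (abs_le.1 h1).1
      linarith
    have hE : (1 - (q : ℝ)) ^ e ≤ Real.exp (-(q * e)) := by
      calc (1 - (q : ℝ)) ^ e ≤ Real.exp (-q) ^ e :=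
            pow_le_pow_left₀ (sub_nonneg.2 q.2.2) (Real.one_sub_le_exp_neg _) e
        _ = Real.exp (-(q * e)) := by
            rw [← Real.exp_nat_mul]
            congr 1
            ring
    have hxM : x ^ M = Real.exp (-(M * Real.log lam)) := by
      rw [← Real.exp_log hx0, ← Real.exp_nat_mul, hx, Real.log_inv]
      congr 1
      ring
    -- The estimate exp(-2y) ≤ 1 - y is valid here since y ≤ 1/2.
    have hden : Real.exp (-(2 * (2 ^ k * x) * n)) ≤ (1 - 2 ^ k * x) ^ n := by
      have hy0 : 0 ≤ 2 ^ k * x := by positivity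
      set y := 2 ^ k * x
      have h1 : Real.exp (-(2 * y)) ≤ 1 - y := by
        have hpos : 0 < 1 - y := by linarith
        rw [Real.exp_neg, inv_le_comm₀ (Real.exp_pos _) hpos]
        calc (1 - y)⁻¹ ≤ 2 * y + 1 := by
              rw [inv_le_iff_one_le_mul₀ hpos]
              nlinarith
          _ ≤ Real.exp (2 * y) := Real.add_one_le_exp _
      calc Real.exp (-(2 * y * n)) = Real.exp (-(2 * y)) ^ n := by
            rw [← Real.exp_nat_mul]
            congr 1
            ring
        _ ≤ (1 - y) ^ n := pow_le_pow_left₀ (Real.exp_pos _).le h1 n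
    rw [Fintype.card_fin]
    calc (1 - (q : ℝ)) ^ e ≤ Real.exp (-(q * e)) := hE
      _ ≤ Real.exp (B + (-(M * Real.log lam) + -(2 * (2 ^ k * x) * n))) := by
          refine Real.exp_le_exp.2 ?_
          have h1 := mul_le_mul_of_nonneg_right hM hlog
          have h2 := mul_le_mul_of_nonneg_left he (by positivity : (0 : ℝ) ≤ q / 2)
          rw [hB, hkx]
          linarith
      _ = Real.exp B * (x ^ M * Real.exp (-(2 * (2 ^ k * x) * n))) := by
          rw [hxM, ← Real.exp_add, ← Real.exp_add]
      _ ≤ Real.exp B * (x ^ M * (1 - 2 ^ k * x) ^ n) := by gcongr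
  have hsum : 1 / 2 ≤ Real.exp B := by
    have hw := sum_prod_pattern_weight_le (V := Fin n) k hx0.le (by linarith)
    calc (1 : ℝ) / 2 ≤ _ := h
      _ ≤ _ := Finset.sum_le_sum hterm
      _ ≤ ∑ τ ∈ Fintype.piFinset (fun _ : Fin n => (Finset.range k).powerset), Real.exp B *
        (x ^ (Finset.univ.filter fun v => (τ v).Nonempty).card *
          (1 - 2 ^ k * x) ^ Fintype.card (Fin n)) := by
          refine Finset.sum_le_sum_of_subset_of_nonneg (Finset.filter_subset _ _) fun τ _ _ => ?_
          have : 0 ≤ 1 - 2 ^ k * x := by linarith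
          positivity
      _ ≤ Real.exp B * 1 := by
          rw [← Finset.mul_sum]
          exact mul_le_mul_of_nonneg_left hw (Real.exp_pos _).le
      _ = Real.exp B := mul_one _
  have := Real.log_le_log (by norm_num) hsum
  rwa [Real.log_exp, one_div, Real.log_inv] at this

end FirstMoment

/-! ### The inequality for fixed λ and large n -/

lemma altSum_smul (k : ℕ) (s : ℝ) (b : ℕ → ℝ) : altSum k (fun i => s * b i) = s * altSum k b := by
  simp only [altSum, Finset.mul_sum]
  exact Finset.sum_congr rfl fun i _ => by ring

lemma altSum_mul_two_sub (k : ℕ) (b : ℕ → ℝ) :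
    ∑ i ∈ Finset.Icc 1 k, (-1 : ℝ) ^ (i - 1) * (k.choose i : ℝ) * (b i * (2 - b i)) =
      2 * altSum k b - altSum k (fun i => b i ^ 2) := by
  simp only [altSum, Finset.mul_sum, ← Finset.sum_sub_distrib]
  exact Finset.sum_congr rfl fun i _ => by ring

/-- The quantitative form of the entropy inequality for large `n`. -/
lemma eventually_le_altSum_alpha {r k : ℕ} {lam : ℝ} (hlam : 3 ≤ lam) (hk : 2 ^ k / lam ≤ 1 / 2)
    (f : ℕ → Factor r) (hind : ∀ᶠ n in atTop, (f n).IsIndepOnER n (edgeProb lam n)) :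
    ∀ᶠ n in atTop, ∀ p : I, -(16 * 2 ^ k / Real.log lam ^ 2) ≤
      ∑ i ∈ Finset.Icc 1 k, (-1 : ℝ) ^ (i - 1) * (k.choose i : ℝ) *
        ((f n).alpha n lam p i * (2 - (f n).alpha n lam p i)) := by
  have hlam0 : 0 < lam := by linarith
  -- Small enough that, after the final scaling by `2 * lam / n`, the deviation errors are bounded
  -- by a multiple of `2 ^ k`.
  set ε : ℝ := 1 / lam ^ 2 with hε
  have hε0 : 0 < ε := by positivity
  set l := Real.log lam with hl
  have hl0 : 0 < l := Real.log_pos (by linarith)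
  have hllam : l ≤ lam := (Real.log_le_sub_one_of_pos hlam0).trans (by linarith)
  -- The thresholds ensure, in order, that the edge probability is not truncated, that the deviation
  -- probabilities sum to at most 1/2, and that the remaining terms of order 1/n add up to at most
  -- 1. None of them depends on `p`.
  filter_upwards [hind, eventually_ge_atTop ⌈lam⌉₊,
    eventually_ge_atTop ⌈2 * 2 ^ k * varianceConst lam r k / ε ^ 2⌉₊,
    eventually_ge_atTop ⌈2 * lam + lam ^ 2⌉₊] with n hn hn1 hn2 hn3 p
  replace hn1 := Nat.ceil_le.1 hn1
  replace hn2 := Nat.ceil_le.1 hn2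
  replace hn3 := Nat.ceil_le.1 hn3
  have hn' : (0 : ℝ) < n := hlam0.trans_le hn1
  have hn0 : n ≠ 0 := by
    rintro rfl
    simp at hn'
  set q := edgeProb lam n with hq
  have hqv : (q : ℝ) = lam / n := edgeProb_eq hlam0.le hn1 hn0
  have hhalf := (f n).half_le_sum_patterns (q := q) (p := p) (k := k) hn
    (c := fun i => n * (f n).interDensity n q p i) (η := ε * n)
    (θ := varianceConst lam r k / (ε ^ 2 * n)) (by
      rw [div_le_iff₀ (by positivity)] at hn2
      rw [← mul_div_assoc, div_le_iff₀ (by positivity)]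
      linarith)
    (fun T hT => (f n).prob_interCount_deviation_le hlam0.le hn0 p
      (fun t ht => Finset.mem_range.1 (hT ht)) hε0)
  have hmain := neg_log_two_le_of_half_le_sum ((f n).interDensity_mem_Icc hn0 q p) hε0.le
    (by linarith) hk hn0 hhalf
  have hs : l / lam ≠ 0 := by positivity
  have ha : ∀ i, (f n).interDensity n q p i = l / lam * (f n).alpha n lam p i := by
    intro i
    rw [Factor.alpha, mul_div_cancel₀ _ hs]
  have ha1 : altSum k ((f n).interDensity n q p) =
      l / lam * altSum k ((f n).alpha n lam p) := by
    rw [← altSum_smul]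
    exact congrArg _ (funext ha)
  have ha2 : altSum k (fun i => (f n).interDensity n q p i ^ 2) =
      (l / lam) ^ 2 * altSum k (fun i => (f n).alpha n lam p i ^ 2) := by
    rw [← altSum_smul]
    refine congrArg _ (funext fun i => ?_)
    rw [ha, mul_pow]
  rw [altSum_mul_two_sub]
  rw [ha1, ha2, hqv] at hmain
  set A := altSum k ((f n).alpha n lam p)
  set B := altSum k (fun i => (f n).alpha n lam p i ^ 2)
  set y : ℝ := 2 ^ k with hy
  have hy1 : 1 ≤ y := one_le_pow₀ (by norm_num)
  have hlog2 : Real.log 2 ≤ 1 := (Real.log_le_sub_one_of_pos (by norm_num)).trans (by norm_num)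
  -- This scaling gives `2 * A - B` the coefficient `l ^ 2`. The errors total at most `8 * y + 1`,
  -- so the constant 16 is generous.
  have hscaled := mul_le_mul_of_nonneg_left hmain (by positivity : 0 ≤ 2 * lam / n)
  have hrhs : 2 * lam / n * (n * (l / lam * A + y * ε) * l + 2 * (y / lam) * n -
      lam / n / 2 * (n ^ 2 * ((l / lam) ^ 2 * B - y * (2 * ε)) - n)) =
      l ^ 2 * (2 * A - B) + 2 * y * (l / lam) + 6 * y + lam ^ 2 / n := by
    rw [hε]
    field_simp
    ring
  rw [hrhs] at hscaled
  have hbound : (2 * lam + lam ^ 2) / n ≤ 1 := (div_le_one hn').2 hn3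
  have hsplit : (2 * lam + lam ^ 2) / n = 2 * lam / n + lam ^ 2 / n := add_div _ _ _
  have h1 : 2 * lam / n * Real.log 2 ≤ 2 * lam / n :=
    mul_le_of_le_one_right (by positivity) hlog2
  have h2 : 2 * y * (l / lam) ≤ 2 * y :=
    mul_le_of_le_one_right (by positivity) ((div_le_one hlam0).2 hllam)
  rw [← neg_div, div_le_iff₀ (by positivity)]
  linarith

end LocalAlg

/-! ### Passage to the limits -/

theorem theorem4p2 (L : Set ℝ) (hLpos : L ⊆ Set.Ioi 0) (hLunb : ¬ BddAbove L)
    (r : ℝ → ℕ) (f : (lam : ℝ) → (n : ℕ) → LocalAlg.Factor (r lam))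
    (hindep : ∀ lam ∈ L, ∀ᶠ n : ℕ in atTop,
      (f lam n).IsIndepOnER n (LocalAlg.edgeProb lam n))
    (k : ℕ) (hk : 1 ≤ k) :
    (0 : EReal) ≤ liminf (fun lam : ℝ => liminf (fun n : ℕ => ⨅ p : I,
      ((∑ i ∈ Finset.Icc 1 k, (-1 : ℝ) ^ (i - 1) * (k.choose i : ℝ) *
        ((f lam n).alpha n lam p i * (2 - (f lam n).alpha n lam p i)) : ℝ) : EReal)) atTop)
      (atTop ⊓ 𝓟 L) := by
  -- Unboundedness of `L` makes the filter proper, so that the limit of the lower bound is also its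
  -- liminf.
  have hne : (atTop ⊓ 𝓟 L).NeBot := by
    refine frequently_mem_iff_neBot.1 (frequently_atTop.2 fun a => ?_)
    obtain ⟨b, hb, hab⟩ := not_bddAbove_iff.1 hLunb a
    exact ⟨b, hab.le, hb⟩
  have hlim : Tendsto (fun lam : ℝ => ((-(16 * 2 ^ k / Real.log lam ^ 2) : ℝ) : EReal))
      (atTop ⊓ 𝓟 L) (nhds 0) := by
    have h : Tendsto (fun lam : ℝ => -(16 * 2 ^ k / Real.log lam ^ 2)) atTop (nhds 0) := by
      rw [← neg_zero]
      refine Tendsto.neg (Tendsto.const_div_atTop ?_ _)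
      exact (tendsto_pow_atTop two_ne_zero).comp Real.tendsto_log_atTop
    exact (EReal.tendsto_coe.2 h).mono_left inf_le_left
  rw [← hlim.liminf_eq]
  refine liminf_le_liminf ?_
  -- The bound 3 keeps the logarithm positive; `2 * 2 ^ k` gives the requirement `2 ^ k / lam ≤ 1 /
  -- 2` of the weight estimate.
  have hlarge : ∀ᶠ lam : ℝ in atTop ⊓ 𝓟 L, max 3 (2 * 2 ^ k) ≤ lam :=
    (eventually_ge_atTop _).filter_mono inf_le_left
  have hmem : ∀ᶠ lam : ℝ in atTop ⊓ 𝓟 L, lam ∈ L :=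
    eventually_inf_principal.2 (Eventually.of_forall fun _ h => h)
  filter_upwards [hlarge, hmem] with lam hlam hL
  have h3 : 3 ≤ lam := (le_max_left _ _).trans hlam
  have hk2 : (2 : ℝ) ^ k / lam ≤ 1 / 2 := by
    have := (le_max_right _ _).trans hlam
    rw [div_le_iff₀ (by linarith)]
    linarith
  refine le_liminf_of_le (by isBoundedDefault) ?_
  filter_upwards [LocalAlg.eventually_le_altSum_alpha h3 hk2 (f lam) (hindep lam hL)] with n hn
  exact le_iInf fun p => EReal.coe_le_coe (hn p)
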